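/- Let $X$ be a (real) Banach lattice with order continuous norm, i.e. $\|x_\alpha\|\to 0$ for every net $x_\alpha\downarrow 0$ in $X$. Call a set $K\subset X$ weakly precompact if every sequence in $K$ has a weakly Cauchy subsequence. Then the following are equivalent: 1. $X$ is weakly compactly generated (WCG): there is a weakly compact set $K\subset X$ whose closed linear span is $X$. 2. $X$ is weakly precompactly generated (WPG): there is a weakly precompact set $K\subset X$ whose closed linear span is $X$. 3. There is a weakly precompact set $K\subset X$ such that $X=B(K)$, where $B(K)$ is the band generated by $K$, that is, the smallest closed linear subspace $Z\supset K$ of $X$ such that $x\in Z$ whenever $|x|\le|y|$ for some $y\in Z$, and such that $\sup A\in Z$ whenever $A\subset Z$ and $\sup A$ exists in $X$. -/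

import Mathlib

open Set Filter Topology

namespace BanachLattice

section BanachSpace

variable {X : Type*} [NormedAddCommGroup X] [NormedSpace ℝ X]

/-- `K` is weakly compact: it is compact for the weak topology of `X`. -/
def IsWeaklyCompact (K : Set X) : Prop :=
  IsCompact (toWeakSpace ℝ X '' K)

/-- A sequence is weakly Cauchy: its image under every continuous linear functional is a
Cauchy sequence of scalars. -/
def IsWeaklyCauchySeq (u : ℕ → X) : Prop :=
  ∀ f : X →L[ℝ] ℝ, CauchySeq fun n => f (u n)

/-- `K` is weakly precompact: every sequence in `K` has a weakly Cauchy subsequence. -/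
def IsWeaklyPrecompact (K : Set X) : Prop :=
  ∀ u : ℕ → X, (∀ n, u n ∈ K) →
    ∃ φ : ℕ → ℕ, StrictMono φ ∧ IsWeaklyCauchySeq fun n => u (φ n)

variable (X)

/-- Weakly compactly generated: `X` is the closed linear span of a weakly compact set. -/
def IsWCG : Prop :=
  ∃ K : Set X, IsWeaklyCompact K ∧ (Submodule.span ℝ K).topologicalClosure = ⊤

/-- Weakly precompactly generated: `X` is the closed linear span of a weakly precompact set. -/
def IsWPG : Prop :=
  ∃ K : Set X, IsWeaklyPrecompact K ∧ (Submodule.span ℝ K).topologicalClosure = ⊤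

end BanachSpace

section Lattice

variable {X : Type*} [NormedAddCommGroup X] [NormedSpace ℝ X] [Lattice X]

/-- A band: a (closed) ideal, i.e. a solid closed linear subspace, that contains the supremum of
each of its subsets whose supremum exists in `X`. -/
structure IsBand (Z : Submodule ℝ X) : Prop where
  isClosed : IsClosed (Z : Set X)
  solid : ∀ ⦃x y : X⦄, y ∈ Z → |x| ≤ |y| → x ∈ Z
  sup_mem : ∀ ⦃S : Set X⦄ ⦃x : X⦄, S ⊆ Z → IsLUB S x → x ∈ Z

/-- The band generated by `A`: the smallest band containing `A`, i.e. the intersection of all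
bands that contain `A`. -/
def bandGenerated (A : Set X) : Submodule ℝ X :=
  sInf {Z : Submodule ℝ X | IsBand Z ∧ A ⊆ Z}

/-- The band generated by a set is indeed a band. -/
theorem isBand_bandGenerated (A : Set X) : IsBand (bandGenerated A) where
  isClosed := by
    rw [bandGenerated, Submodule.coe_sInf]
    exact isClosed_biInter fun Z hZ => hZ.1.isClosed
  solid x y hy hxy := by
    rw [bandGenerated, Submodule.mem_sInf] at hy ⊢
    exact fun Z hZ => hZ.1.solid (hy Z hZ) hxy
  sup_mem S x hS hx := by
    rw [bandGenerated, Submodule.mem_sInf]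
    exact fun Z hZ => hZ.1.sup_mem (fun s hs => (Submodule.mem_sInf.1 (hS hs)) Z hZ) hx

end Lattice

/-- The norm of `X` is order continuous: `x_α ↓ 0` implies `‖x_α‖ → 0`. A decreasing net is given
by its set of values `D`, a nonempty downward directed set; as the norm is monotone on the positive
cone, the norms tend to `0` along the net if and only if they get arbitrarily small on `D`. -/
def IsOrderContinuous (X : Type*) [NormedAddCommGroup X] [Lattice X] : Prop :=
  ∀ D : Set X, D.Nonempty → DirectedOn (fun x y => y ≤ x) D → IsGLB D 0 →
    ∀ ε : ℝ, 0 < ε → ∃ x ∈ D, ‖x‖ < ε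

end BanachLattice

/-!
The substantial implication is that a Banach lattice `X` with order continuous norm is WCG as soon
as it is generated, as a band, by a weakly precompact set `K`.

By Zorn's lemma there is a maximal disjoint family `E` of positive elements each of which lies below
`x⁺` or `x⁻` for some `x ∈ K` (`exists_maximal_disjoint_family`). The weakly compact set is
`L = {0} ∪ ⋃ e ∈ E, [0, e]`.

* The closed span of `L` is `X` (`topologicalClosure_span_iUnion_Icc`): since `K` generates `X` as a
  band, only `0` is disjoint from all of `E`, so by order continuity every `x ≥ 0` is the norm limit
  of `x ⊓ n • ∑ e ∈ t, e`, with `t` a finite subset of `E`.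
* Sequences of distinct elements of `E` are weakly null (`exists_apply_lt_of_disjoint`). Otherwise
  some positive functional `f` is at least `δ > 0` on a disjoint sequence `e n ≤ (± x n)⁺`, with
  `x n ∈ K`, and the functionals `± f ∘ P n`, with `P n` the projection onto the band of `e n`, are the
  coordinates of an operator from `X` to `ℓ¹`. It maps a weakly Cauchy subsequence of `x` to a
  sequence whose diagonal coordinates stay above `δ`, against the Schur property of `ℓ¹`
  (`exists_abs_diagonal_lt`).
* Each interval `[0, e]` is weakly compact (`exists_weak_limit_of_Icc`). The limit of an ultrafilter
  on `[0, e]` in the bidual is some `φ` with `0 ≤ φ ≤ e`, and a maximal `x ∈ X` below `φ` equals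
  `φ`, because a nonzero `ψ` with `0 ≤ ψ ≤ e` dominates a nonzero positive element of `X`
  (`exists_pos_le_of_bidual`). The latter takes Hahn decompositions, over elements of `X` and over
  operators between `0` and the identity.

So only intervals of finitely many `e ∈ E` can leave a given weak neighbourhood of `0`, and `L` is
weakly compact (`isWeaklyCompact_insert_iUnion_Icc`).

That a weakly compact set is weakly precompact is the easy half of the Eberlein-Šmulian theorem
(`IsWeaklyCompact.isWeaklyPrecompact`), and a band that contains `K` contains its closed span.
-/

namespace BanachLattice

/-! ### Lattice inequalities -/

section LatticeInequalities

variable {X : Type*} [AddCommGroup X] [Lattice X] [IsOrderedAddMonoid X]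

lemma inf_add_le_inf_add_inf {x a b : X} (hx : 0 ≤ x) (ha : 0 ≤ a) (hb : 0 ≤ b) :
    x ⊓ (a + b) ≤ x ⊓ a + x ⊓ b := by
  rw [inf_add, add_inf, add_inf]
  refine le_inf (le_inf ?_ ?_) (le_inf ?_ ?_)
  · exact inf_le_left.trans (le_add_of_nonneg_left hx)
  · exact inf_le_left.trans (le_add_of_nonneg_right hb)
  · exact inf_le_left.trans (le_add_of_nonneg_left ha)
  · exact inf_le_right

lemma add_inf_le_inf_add_inf {x y a : X} (hx : 0 ≤ x) (hy : 0 ≤ y) (ha : 0 ≤ a) :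
    (x + y) ⊓ a ≤ x ⊓ a + y ⊓ a := by
  simpa only [inf_comm] using inf_add_le_inf_add_inf ha hx hy

lemma inf_add_inf_le_add_inf_add (x y a b : X) : x ⊓ a + y ⊓ b ≤ (x + y) ⊓ (a + b) :=
  le_inf (add_le_add inf_le_left inf_le_left) (add_le_add inf_le_right inf_le_right)

lemma add_le_of_inf_eq_zero {a b x : X} (hab : a ⊓ b = 0) (ha : a ≤ x) (hb : b ≤ x) :
    a + b ≤ x := by
  rw [← inf_add_sup, hab, zero_add]
  exact sup_le ha hb

lemma nsmul_inf_eq_zero {a b : X} (ha : 0 ≤ a) (hb : 0 ≤ b) (h : a ⊓ b = 0) (n : ℕ) :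
    (n • a) ⊓ b = 0 := by
  induction n with
  | zero => simpa using hb
  | succ n ih =>
    refine le_antisymm ?_ (le_inf (nsmul_nonneg ha _) hb)
    rw [succ_nsmul]
    refine (add_inf_le_inf_add_inf (nsmul_nonneg ha _) ha hb).trans ?_
    rw [ih, h, add_zero]

lemma add_inf_eq_zero {a b c : X} (ha : 0 ≤ a) (hb : 0 ≤ b) (hc : 0 ≤ c)
    (hac : a ⊓ c = 0) (hbc : b ⊓ c = 0) : (a + b) ⊓ c = 0 := by
  refine le_antisymm ?_ (le_inf (add_nonneg ha hb) hc)
  refine (add_inf_le_inf_add_inf ha hb hc).trans ?_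
  rw [hac, hbc, add_zero]

lemma sum_inf_eq_zero {ι : Type*} (s : Finset ι) {a : ι → X} {c : X} (ha : ∀ i ∈ s, 0 ≤ a i)
    (hc : 0 ≤ c) (hac : ∀ i ∈ s, a i ⊓ c = 0) : (∑ i ∈ s, a i) ⊓ c = 0 := by
  classical
  induction s using Finset.induction_on with
  | empty => simpa using hc
  | insert i s hi ih =>
    rw [Finset.sum_insert hi]
    simp only [Finset.mem_insert, forall_eq_or_imp] at ha hac
    exact add_inf_eq_zero ha.1 (Finset.sum_nonneg ha.2) hc hac.1 (ih ha.2 hac.2)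

lemma sum_le_of_pairwise_inf_eq_zero {ι : Type*} (s : Finset ι) {a : ι → X} {x : X} (hx : 0 ≤ x)
    (ha : ∀ i, 0 ≤ a i) (hax : ∀ i, a i ≤ x) (hd : ∀ i j, i ≠ j → a i ⊓ a j = 0) :
    ∑ i ∈ s, a i ≤ x := by
  classical
  induction s using Finset.induction_on with
  | empty => simpa using hx
  | insert i s hi ih =>
    rw [Finset.sum_insert hi, add_comm]
    refine add_le_of_inf_eq_zero (sum_inf_eq_zero s (fun j _ => ha j) (ha i) ?_) ih (hax i)
    exact fun j hj => hd j i (by rintro rfl; exact hi hj)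

lemma posPart_add_le_add (x y : X) : (x + y)⁺ ≤ x⁺ + y⁺ :=
  sup_le (add_le_add (le_posPart x) (le_posPart y))
    (add_nonneg (posPart_nonneg x) (posPart_nonneg y))

lemma negPart_add_le_add (x y : X) : (x + y)⁻ ≤ x⁻ + y⁻ := by
  simpa only [← posPart_neg, neg_add] using posPart_add_le_add (-x) (-y)

lemma monotone_inf_nsmul (x : X) {u : X} (hu : 0 ≤ u) : Monotone fun n : ℕ => x ⊓ n • u :=
  fun _ _ h => inf_le_inf le_rfl (nsmul_le_nsmul_left hu h)

end LatticeInequalities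

section Module

variable {X : Type*} [AddCommGroup X] [Lattice X] [Module ℝ X] [IsOrderedModule ℝ X]

lemma posPart_smul_of_pos {c : ℝ} (hc : 0 < c) (x : X) :
    (c • x)⁺ = c • x⁺ := by
  have := (OrderIso.smulRight (β := X) hc).map_sup x 0
  simp only [OrderIso.smulRight_apply, smul_zero] at this
  exact this.symm

lemma negPart_smul_of_pos [IsOrderedAddMonoid X] {c : ℝ} (hc : 0 < c) (x : X) :
    (c • x)⁻ = c • x⁻ := by
  rw [← posPart_neg, ← smul_neg, posPart_smul_of_pos hc, posPart_neg]

end Module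

/-! ### Positive operators and positive functionals -/

section Positive

variable {X Y : Type*} [NormedAddCommGroup X] [NormedSpace ℝ X] [Lattice X]
  [NormedAddCommGroup Y] [NormedSpace ℝ Y] [Lattice Y]

/-- A bounded operator is positive if it maps the positive cone into the positive cone. -/
def IsPositiveMap (T : X →L[ℝ] Y) : Prop := ∀ x, 0 ≤ x → 0 ≤ T x

lemma IsPositiveMap.mono [IsOrderedAddMonoid X] [IsOrderedAddMonoid Y] {T : X →L[ℝ] Y}
    (hT : IsPositiveMap T) {x y : X} (h : x ≤ y) : T x ≤ T y := by
  have := hT (y - x) (sub_nonneg.2 h)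
  rwa [map_sub, sub_nonneg] at this

lemma IsPositiveMap.comp {Z : Type*} [NormedAddCommGroup Z] [NormedSpace ℝ Z] [Lattice Z]
    {f : Y →L[ℝ] Z} {T : X →L[ℝ] Y} (hf : IsPositiveMap f) (hT : IsPositiveMap T) :
    IsPositiveMap (f.comp T) :=
  fun x hx => hf _ (hT x hx)

lemma IsPositiveMap.abs_apply_le [IsOrderedAddMonoid X] {f : X →L[ℝ] ℝ} (hf : IsPositiveMap f)
    (x : X) : |f x| ≤ f |x| := by
  refine abs_le'.2 ⟨hf.mono (le_abs_self x), ?_⟩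
  rw [← map_neg]
  exact hf.mono (neg_le_abs x)

end Positive

section SolidNorm

variable {X : Type*} [NormedAddCommGroup X] [Lattice X] [IsOrderedAddMonoid X] [HasSolidNorm X]

lemma norm_le_norm_of_nonneg_of_le {x y : X} (hx : 0 ≤ x) (hxy : x ≤ y) : ‖x‖ ≤ ‖y‖ := by
  refine norm_le_norm_of_abs_le_abs ?_
  rwa [abs_of_nonneg hx, abs_of_nonneg (hx.trans hxy)]

lemma norm_posPart_le (x : X) : ‖x⁺‖ ≤ ‖x‖ := by
  rw [← norm_abs_eq_norm x]
  refine norm_le_norm_of_nonneg_of_le (posPart_nonneg _) ?_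
  rw [← posPart_add_negPart]
  exact le_add_of_nonneg_right (negPart_nonneg _)

lemma norm_negPart_le (x : X) : ‖x⁻‖ ≤ ‖x‖ := by simpa using norm_posPart_le (-x)

variable [NormedSpace ℝ X] [IsOrderedModule ℝ X]

/-- Every bounded functional is a difference of positive ones. The two parts come from one
Hahn-Banach extension: `(x, x) ↦ f x` on the diagonal of `X × X` is dominated by
`‖f‖ * ‖x⁺ + y⁻‖`. -/
lemma exists_positive_sub_positive (f : X →L[ℝ] ℝ) :
    ∃ g h : X →L[ℝ] ℝ, IsPositiveMap g ∧ IsPositiveMap h ∧ f = g - h := by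
  let q : X × X → ℝ := fun p => ‖f‖ * ‖p.1⁺ + p.2⁻‖
  have hq : ∀ p, q p = ‖f‖ * ‖p.1⁺ + p.2⁻‖ := fun p => rfl
  let D : X →ₗ[ℝ] X × X := LinearMap.prod LinearMap.id LinearMap.id
  let F : (X × X) →ₗ.[ℝ] ℝ :=
    { domain := LinearMap.range D
      toFun := f.toLinearMap ∘ₗ LinearMap.fst ℝ X X ∘ₗ (LinearMap.range D).subtype }
  obtain ⟨G, hG, hGq⟩ := exists_extension_of_le_sublinear F q
    (fun c hc p => by
      simp only [hq, Prod.smul_fst, Prod.smul_snd, posPart_smul_of_pos hc, negPart_smul_of_pos hc,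
        ← smul_add, norm_smul, Real.norm_of_nonneg hc.le]
      ring)
    (fun p p' => by
      simp only [hq, Prod.fst_add, Prod.snd_add, ← mul_add]
      refine mul_le_mul_of_nonneg_left (le_trans ?_ (norm_add_le _ _)) (norm_nonneg _)
      refine norm_le_norm_of_nonneg_of_le
        (add_nonneg (posPart_nonneg _) (negPart_nonneg _)) ?_
      refine (add_le_add (posPart_add_le_add _ _) (negPart_add_le_add _ _)).trans (le_of_eq ?_)
      abel)
    (by
      rintro ⟨_, x, rfl⟩
      change f x ≤ ‖f‖ * ‖x⁺ + x⁻‖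
      rw [posPart_add_negPart, norm_abs_eq_norm]
      exact (le_abs_self _).trans (f.le_opNorm x))
  have hdiag : ∀ x, G (x, x) = f x := fun x => hG ⟨(x, x), x, rfl⟩
  let g₀ : X →ₗ[ℝ] ℝ := G ∘ₗ LinearMap.inl ℝ X X
  let h₀ : X →ₗ[ℝ] ℝ := -(G ∘ₗ LinearMap.inr ℝ X X)
  have hg₀ : ∀ x, g₀ x ≤ ‖f‖ * ‖x⁺‖ := fun x => by
    simpa [hq, g₀] using hGq (x, 0)
  have hh₀ : ∀ x, -h₀ x ≤ ‖f‖ * ‖x⁻‖ := fun x => by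
    simpa [hq, h₀] using hGq (0, x)
  have bound : ∀ (k : X →ₗ[ℝ] ℝ), (∀ x, k x ≤ ‖f‖ * ‖x‖) → ∀ x, ‖k x‖ ≤ ‖f‖ * ‖x‖ := by
    intro k hk x
    refine abs_le'.2 ⟨hk x, ?_⟩
    have := hk (-x)
    rwa [map_neg, norm_neg] at this
  have hh₁ : ∀ x, h₀ x ≤ ‖f‖ * ‖x‖ := fun x => by
    have := hh₀ (-x)
    rw [map_neg, neg_neg] at this
    exact this.trans (mul_le_mul_of_nonneg_left
      ((norm_negPart_le _).trans_eq (norm_neg x)) (norm_nonneg _))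
  refine ⟨g₀.mkContinuous ‖f‖ (bound g₀ fun x => (hg₀ x).trans
      (mul_le_mul_of_nonneg_left (norm_posPart_le x) (norm_nonneg _))),
    h₀.mkContinuous ‖f‖ (bound h₀ hh₁), ?_, ?_, ?_⟩
  · intro x hx
    have := hg₀ (-x)
    rw [map_neg, posPart_neg, negPart_of_nonneg hx, norm_zero, mul_zero] at this
    simpa using this
  · intro x hx
    have := hh₀ x
    rw [negPart_of_nonneg hx, norm_zero, mul_zero] at this
    simpa using this
  · ext x
    rw [← hdiag x]
    simp only [sub_apply, LinearMap.mkContinuous_apply, g₀, h₀,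
      LinearMap.comp_apply, LinearMap.neg_apply, sub_neg_eq_add, ← map_add]
    simp

/-- Positive functionals determine the order. -/
lemma nonneg_of_forall_positive {z : X}
    (h : ∀ f : X →L[ℝ] ℝ, IsPositiveMap f → 0 ≤ f z) : 0 ≤ z := by
  by_contra hz
  obtain ⟨f, u, hfz, hu⟩ := geometric_hahn_banach_point_closed (t := {x : X | 0 ≤ x})
    (convex_Ici (0 : X)) isClosed_nonneg hz
  have hu0 : u < 0 := by simpa using hu 0 (le_refl (0 : X))
  have hf : IsPositiveMap f := by
    intro x hx
    by_contra hneg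
    rw [not_le] at hneg
    have := hu ((u / f x) • x) (smul_nonneg (div_pos_of_neg_of_neg hu0 hneg).le hx)
    rw [map_smul, smul_eq_mul, div_mul_cancel₀ _ hneg.ne] at this
    exact lt_irrefl _ this
  linarith [h f hf]

end SolidNorm

/-! ### Consequences of order continuity -/

section OrderContinuity

variable {X : Type*} [NormedAddCommGroup X] [NormedSpace ℝ X] [Lattice X] [IsOrderedAddMonoid X]
  [HasSolidNorm X]

lemma nonpos_of_forall_nsmul_posPart_le {x y : X} (h : ∀ n : ℕ, n • x⁺ ≤ y) : x ≤ 0 := by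
  have hn : ∀ n : ℕ, n * ‖x⁺‖ ≤ ‖y‖ := fun n => by
    have := norm_le_norm_of_nonneg_of_le (nsmul_nonneg (posPart_nonneg x) n) (h n)
    rwa [← Nat.cast_smul_eq_nsmul ℝ, norm_smul, Real.norm_natCast] at this
  have h0 : ‖x⁺‖ ≤ 0 := by
    by_contra hpos
    rw [not_le] at hpos
    obtain ⟨n, hlt⟩ := exists_nat_gt (‖y‖ / ‖x⁺‖)
    rw [div_lt_iff₀ hpos] at hlt
    exact absurd (hn n) (not_le.2 hlt)
  exact posPart_eq_zero.1 (norm_le_zero_iff.1 h0)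

/-- In a Banach lattice with order continuous norm, increasing nets that are bounded above converge
in norm: the differences `b - u i`, with `b` running through the upper bounds of the net, decrease
to `0`. -/
lemma exists_tendsto_of_monotone [CompleteSpace X] (hX : IsOrderContinuous X) {ι : Type*}
    [Preorder ι] [IsDirectedOrder ι] [Nonempty ι] {u : ι → X} (hu : Monotone u) {b₀ : X}
    (hb₀ : ∀ i, u i ≤ b₀) : ∃ s, Tendsto u atTop (𝓝 s) := by
  let D : Set X := {d | ∃ b i, (∀ j, u j ≤ b) ∧ d = b - u i}
  have hD : IsGLB D 0 := by
    refine ⟨?_, fun d hd => ?_⟩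
    · rintro _ ⟨b, i, hb, rfl⟩
      exact sub_nonneg.2 (hb i)
    · have key : ∀ n : ℕ, ∀ j, u j ≤ b₀ - n • d⁺ := by
        intro n
        induction n with
        | zero => simpa using hb₀
        | succ n ih =>
          intro j
          have h1 : d ≤ b₀ - n • d⁺ - u j := hd ⟨_, j, ih, rfl⟩
          have h2 : d⁺ ≤ b₀ - n • d⁺ - u j := sup_le h1 (sub_nonneg.2 (ih j))
          rw [succ_nsmul, ← sub_sub]
          exact le_sub_comm.1 h2
      obtain ⟨j⟩ := ‹Nonempty ι›
      exact nonpos_of_forall_nsmul_posPart_le fun n => le_sub_comm.1 (key n j)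
  have hdir : DirectedOn (fun x y => y ≤ x) D := by
    rintro _ ⟨b, i, hb, rfl⟩ _ ⟨b', i', hb', rfl⟩
    obtain ⟨k, hk, hk'⟩ := exists_ge_ge i i'
    exact ⟨b ⊓ b' - u k, ⟨_, k, fun j => le_inf (hb j) (hb' j), rfl⟩,
      sub_le_sub inf_le_left (hu hk), sub_le_sub inf_le_right (hu hk')⟩
  have hne : D.Nonempty := by
    obtain ⟨j⟩ := ‹Nonempty ι›
    exact ⟨_, b₀, j, hb₀, rfl⟩
  refine CompleteSpace.complete (f := map u atTop) (Metric.cauchy_iff.2 ⟨inferInstance, ?_⟩)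
  intro ε hε
  obtain ⟨_, ⟨b, i, hb, rfl⟩, hlt⟩ := hX D hne hdir hD (ε / 2) (half_pos hε)
  have hclose : ∀ j, i ≤ j → ‖u j - u i‖ < ε / 2 := fun j hij =>
    (norm_le_norm_of_nonneg_of_le (sub_nonneg.2 (hu hij)) (sub_le_sub_right (hb j) _)).trans_lt hlt
  refine ⟨u '' Ici i, image_mem_map (Ici_mem_atTop i), ?_⟩
  rintro _ ⟨j, hj, rfl⟩ _ ⟨k, hk, rfl⟩
  calc dist (u j) (u k) ≤ dist (u j) (u i) + dist (u k) (u i) := dist_triangle_right _ _ _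
    _ < ε / 2 + ε / 2 := by
      rw [dist_eq_norm, dist_eq_norm]
      exact add_lt_add (hclose j hj) (hclose k hk)
    _ = ε := add_halves ε

end OrderContinuity

/-! ### A Hahn decomposition -/

/-- Exhaustion argument behind Hahn decompositions. If the increasing chains in `[0, T]` along which
`μ` decreases have bounds, then below `T` there is some `Q` with `μ T ≤ μ Q` on which `μ` is
strictly positive: remove from `T` a maximal `S` with `μ S ≤ 0`. -/
lemma exists_hahn_decomposition {E : Type*} [AddCommGroup E] [PartialOrder E]
    [IsOrderedAddMonoid E] (μ : E →+ ℝ) {T : E} (hT : 0 ≤ T)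
    (hμ : ∀ c : Set E, c.Nonempty → IsChain (· ≤ ·) c → (∀ S ∈ c, 0 ≤ S ∧ S ≤ T) →
      (∀ S ∈ c, ∀ S' ∈ c, S ≤ S' → μ S' ≤ μ S) → ∃ L ≤ T, ∀ S ∈ c, S ≤ L ∧ μ L ≤ μ S) :
    ∃ Q, 0 ≤ Q ∧ Q ≤ T ∧ μ T ≤ μ Q ∧ ∀ R, 0 ≤ R → R ≤ Q → R ≠ 0 → 0 < μ R := by
  let α := {S : E // 0 ≤ S ∧ S ≤ T ∧ μ S ≤ 0}
  let r : α → α → Prop := fun S S' => S.1 ≤ S'.1 ∧ μ S'.1 ≤ μ S.1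
  have : Nonempty α := ⟨⟨0, le_rfl, hT, (map_zero μ).le⟩⟩
  obtain ⟨⟨S, hS0, hST, hSμ⟩, hmax⟩ := exists_maximal_of_nonempty_chains_bounded (r := r)
    (fun c hc hne => by
      obtain ⟨L, hLT, hL⟩ := hμ (Subtype.val '' c) (hne.image _)
        (by
          rintro _ ⟨S, hS, rfl⟩ _ ⟨S', hS', rfl⟩ hSS'
          exact (hc hS hS' fun h => hSS' (congrArg _ h)).imp And.left And.left)
        (by
          rintro _ ⟨S, hS, rfl⟩
          exact ⟨S.2.1, S.2.2.1⟩)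
        (by
          rintro _ ⟨S, hS, rfl⟩ _ ⟨S', hS', rfl⟩ hle
          by_cases h : S = S'
          · rw [h]
          · rcases hc hS hS' h with h1 | h1
            · exact h1.2
            · rw [le_antisymm hle h1.1])
      obtain ⟨S₀, hS₀⟩ := hne
      have h₀ := hL _ (mem_image_of_mem _ hS₀)
      exact ⟨⟨L, S₀.2.1.trans h₀.1, hLT, h₀.2.trans S₀.2.2.2⟩,
        fun S hS => hL _ (mem_image_of_mem _ hS)⟩)
    (fun h h' => ⟨h.1.trans h'.1, h'.2.trans h.2⟩)
  refine ⟨T - S, sub_nonneg.2 hST, sub_le_self _ hS0, ?_, fun R hR0 hR hne => ?_⟩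
  · rw [map_sub]
    linarith
  · by_contra hneg
    rw [not_lt] at hneg
    have hadd : μ (S + R) ≤ μ S := by rw [map_add]; linarith
    have := (hmax ⟨S + R, add_nonneg hS0 hR0, le_sub_iff_add_le'.1 hR, hadd.trans hSμ⟩
      ⟨le_add_of_nonneg_right hR0, hadd⟩).1
    exact hne (le_antisymm (by simpa using this) hR0)
section HahnOperators

variable {X : Type*} [NormedAddCommGroup X] [NormedSpace ℝ X] [CompleteSpace X] [Lattice X]
  [IsOrderedAddMonoid X] [HasSolidNorm X]

/-- Hahn decomposition for a functional on an order interval of `X`. -/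
lemma exists_hahn_element (hX : IsOrderContinuous X) (f : X →L[ℝ] ℝ) {u : X} (hu : 0 ≤ u) :
    ∃ v, 0 ≤ v ∧ v ≤ u ∧ f u ≤ f v ∧ ∀ w, 0 ≤ w → w ≤ v → w ≠ 0 → 0 < f w := by
  refine exists_hahn_decomposition (f : X →+ ℝ) hu fun c hne hc hcu hanti => ?_
  have : Nonempty c := hne.to_subtype
  have : IsDirectedOrder c := ⟨hc.directed⟩
  have hmono : Monotone ((↑) : c → X) := Subtype.mono_coe c
  obtain ⟨s, hs⟩ := exists_tendsto_of_monotone hX hmono fun i => (hcu _ i.2).2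
  refine ⟨s, le_of_tendsto' hs fun i => (hcu _ i.2).2, fun S hS => ⟨hmono.ge_of_tendsto hs ⟨S, hS⟩,
    le_of_tendsto ((f.continuous.tendsto s).comp hs) ?_⟩⟩
  filter_upwards [Ici_mem_atTop (⟨S, hS⟩ : c)] with i hi using hanti S hS i i.2 hi

/-- The order on bounded operators for which the nonnegative operators are the positive ones. -/
abbrev operatorOrder (X : Type*) [NormedAddCommGroup X] [NormedSpace ℝ X] [Lattice X]
    [IsOrderedAddMonoid X] : PartialOrder (X →L[ℝ] X) where
  le S T := ∀ x, 0 ≤ x → S x ≤ T x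
  le_refl _ _ _ := le_rfl
  le_trans _ _ _ h h' x hx := (h x hx).trans (h' x hx)
  le_antisymm S T h h' := by
    ext x
    rw [← posPart_sub_negPart x, map_sub, map_sub,
      le_antisymm (h _ (posPart_nonneg x)) (h' _ (posPart_nonneg x)),
      le_antisymm (h _ (negPart_nonneg x)) (h' _ (negPart_nonneg x))]

/-- Hahn decomposition for an additive function of positive operators which is controlled by the
value of the operator at a single vector `e`. -/
lemma exists_hahn_operator (hX : IsOrderContinuous X) (μ : (X →L[ℝ] X) →+ ℝ) {e : X} {C : ℝ}
    (hC : ∀ R, IsPositiveMap R → |μ R| ≤ C * ‖R e‖) {T : X →L[ℝ] X}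
    (hT : IsPositiveMap T) :
    ∃ Q, IsPositiveMap Q ∧ IsPositiveMap (T - Q) ∧ μ T ≤ μ Q ∧
      ∀ R, IsPositiveMap R → IsPositiveMap (Q - R) → R ≠ 0 → 0 < μ R := by
  let := operatorOrder X
  have : IsOrderedAddMonoid (X →L[ℝ] X) :=
    { add_le_add_left := fun S T h U x hx => add_le_add_left (h x hx) (U x)
      add_le_add_right := fun S T h U x hx => add_le_add_right (h x hx) (U x) }
  have hpos : ∀ S : X →L[ℝ] X, 0 ≤ S ↔ IsPositiveMap S := fun _ => Iff.rfl
  simp only [← hpos, sub_nonneg] at hT hC ⊢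
  refine exists_hahn_decomposition μ hT fun c hne hc hcT hanti => ?_
  have : Nonempty c := hne.to_subtype
  have : IsDirectedOrder c := ⟨hc.directed⟩
  have hmono : ∀ x, 0 ≤ x → Monotone fun S : c => (S : X →L[ℝ] X) x :=
    fun x hx S S' h => h x hx
  have hbd : ∀ x, 0 ≤ x → ∀ S : c, (S : X →L[ℝ] X) x ≤ T x := fun x hx S => (hcT _ S.2).2 x hx
  have hlim : ∀ x, ∃ y, Tendsto (fun S : c => (S : X →L[ℝ] X) x) atTop (𝓝 y) := by
    intro x
    obtain ⟨y, hy⟩ := exists_tendsto_of_monotone hX (hmono _ (posPart_nonneg x))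
      (hbd _ (posPart_nonneg x))
    obtain ⟨z, hz⟩ := exists_tendsto_of_monotone hX (hmono _ (negPart_nonneg x))
      (hbd _ (negPart_nonneg x))
    refine ⟨y - z, (hy.sub hz).congr fun S => ?_⟩
    rw [← map_sub, posPart_sub_negPart]
  choose L hL using hlim
  let L₀ : X →ₗ[ℝ] X := linearMapOfTendsto L (fun S : c => (S : X →L[ℝ] X).toLinearMap)
    (tendsto_pi_nhds.2 hL)
  have hLT : ∀ x, 0 ≤ x → L x ≤ T x := fun x hx => le_of_tendsto' (hL x) (hbd x hx)
  have hSL : ∀ x, 0 ≤ x → ∀ S ∈ c, S x ≤ L x := fun x hx S hS =>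
    (hmono x hx).ge_of_tendsto (hL x) ⟨S, hS⟩
  obtain ⟨S₀, hS₀⟩ := hne
  have hL0 : ∀ x, 0 ≤ x → 0 ≤ L x := fun x hx => ((hcT _ hS₀).1 x hx).trans (hSL x hx S₀ hS₀)
  have hbound : ∀ x, ‖L₀ x‖ ≤ (2 * ‖T‖) * ‖x‖ := by
    intro x
    have h1 : ∀ y, 0 ≤ y → ‖y‖ ≤ ‖x‖ → ‖L₀ y‖ ≤ ‖T‖ * ‖x‖ := fun y hy hyx =>
      (norm_le_norm_of_nonneg_of_le (hL0 y hy) (hLT y hy)).trans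
        ((T.le_opNorm y).trans (mul_le_mul_of_nonneg_left hyx (norm_nonneg _)))
    rw [← posPart_sub_negPart x, map_sub, posPart_sub_negPart]
    refine (norm_sub_le _ _).trans ?_
    linarith [h1 _ (posPart_nonneg x) (norm_posPart_le x),
      h1 _ (negPart_nonneg x) (norm_negPart_le x)]
  let L₁ : X →L[ℝ] X := L₀.mkContinuous _ hbound
  refine ⟨L₁, hLT, fun S hS => ⟨fun x hx => hSL x hx S hS, ?_⟩⟩
  have hto : Tendsto (fun S : c => μ S) atTop (𝓝 (μ L₁)) := by
    have h0 : Tendsto (fun S : c => C * ‖(L₁ - (S : X →L[ℝ] X)) e‖) atTop (𝓝 0) := by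
      have h : Tendsto (fun S : c => C * ‖(L₁ - (S : X →L[ℝ] X)) e‖) atTop
          (𝓝 (C * ‖L e - L e‖)) :=
        ((tendsto_const_nhds (x := L e)).sub (hL e)).norm.const_mul C
      rwa [sub_self, norm_zero, mul_zero] at h
    have h1 : Tendsto (fun S : c => μ L₁ - μ S) atTop (𝓝 0) := by
      refine squeeze_zero_norm (fun S => ?_) h0
      rw [← map_sub]
      exact hC _ (sub_nonneg.2 fun x hx => hSL x hx S S.2)
    simpa using (tendsto_const_nhds (x := μ L₁)).sub h1
  refine le_of_tendsto hto ?_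
  filter_upwards [Ici_mem_atTop (⟨S, hS⟩ : c)] with i hi using hanti S hS i i.2 hi

end HahnOperators

/-! ### Band projections -/

section BandProjection

variable {X : Type*} [NormedAddCommGroup X] [NormedSpace ℝ X] [Lattice X]
  [IsOrderedAddMonoid X] [HasSolidNorm X]

/-- `P` is the projection onto the band generated by `u ≥ 0`, described by its values
`P x = sup (x ⊓ n • u)` on the positive cone. -/
def IsBandProjection (u : X) (P : X →L[ℝ] X) : Prop :=
  ∀ x, 0 ≤ x → Tendsto (fun n : ℕ => x ⊓ n • u) atTop (𝓝 (P x))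

lemma exists_isBandProjection [CompleteSpace X] (hX : IsOrderContinuous X) {u : X} (hu : 0 ≤ u) :
    ∃ P, IsBandProjection u P := by
  have hlim : ∀ x, ∃ y, Tendsto (fun n : ℕ => x⁺ ⊓ n • u) atTop (𝓝 y) := fun x =>
    exists_tendsto_of_monotone hX (monotone_inf_nsmul _ hu) fun _ => inf_le_left
  choose L hL using hlim
  have hL' : ∀ x, 0 ≤ x → Tendsto (fun n : ℕ => x ⊓ n • u) atTop (𝓝 (L x)) := fun x hx => by
    simpa only [posPart_of_nonneg hx] using hL x
  have hL0 : ∀ x, 0 ≤ L x := fun x =>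
    ge_of_tendsto' (hL x) fun n => le_inf (posPart_nonneg x) (nsmul_nonneg hu n)
  have hLle : ∀ x, L x ≤ x⁺ := fun x => le_of_tendsto' (hL x) fun n => inf_le_left
  have hLadd : ∀ x y, 0 ≤ x → 0 ≤ y → L (x + y) = L x + L y := by
    intro x y hx hy
    refine le_antisymm ?_ ?_
    · exact le_of_tendsto_of_tendsto' (hL' _ (add_nonneg hx hy)) ((hL' x hx).add (hL' y hy))
        fun n => add_inf_le_inf_add_inf hx hy (nsmul_nonneg hu n)
    · refine le_of_tendsto_of_tendsto' ((hL' x hx).add (hL' y hy))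
        ((hL' _ (add_nonneg hx hy)).comp (tendsto_id.const_mul_atTop' two_pos)) fun n => ?_
      refine (inf_add_inf_le_add_inf_add _ _ _ _).trans_eq ?_
      simp only [Function.comp, id, two_mul, add_nsmul]
  let A : X →+ X := AddMonoidHom.mk' (fun x => L x⁺ - L x⁻) fun x y => by
    have h := congrArg L (show (x + y)⁺ + (x⁻ + y⁻) = (x⁺ + y⁺) + (x + y)⁻ by
      have h1 := posPart_sub_negPart (x + y)
      have h2 := posPart_sub_negPart x
      have h3 := posPart_sub_negPart y
      rw [← sub_eq_zero]
      calc _ = ((x + y)⁺ - (x + y)⁻) - ((x⁺ - x⁻) + (y⁺ - y⁻)) := by abel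
        _ = 0 := by rw [h1, h2, h3, sub_self])
    have p := fun z : X => posPart_nonneg z
    have q := fun z : X => negPart_nonneg z
    rw [hLadd _ _ (p _) (add_nonneg (q _) (q _)), hLadd _ _ (q _) (q _),
      hLadd _ _ (add_nonneg (p _) (p _)) (q _), hLadd _ _ (p _) (p _)] at h
    rw [← sub_eq_zero] at h ⊢
    rw [← h]
    abel
  have hAbound : ∀ x, ‖A x‖ ≤ 2 * ‖x‖ := by
    intro x
    have h1 : ∀ y, 0 ≤ y → ‖L y‖ ≤ ‖y‖ := fun y hy =>
      norm_le_norm_of_nonneg_of_le (hL0 y) ((hLle y).trans_eq (posPart_of_nonneg hy))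
    refine (norm_sub_le _ _).trans ?_
    linarith [h1 _ (posPart_nonneg x), h1 _ (negPart_nonneg x), norm_posPart_le x,
      norm_negPart_le x]
  refine ⟨A.toRealLinearMap (AddMonoidHomClass.continuous_of_bound A 2 hAbound), fun x hx => ?_⟩
  have hz : L 0 = 0 := le_antisymm ((hLle 0).trans_eq posPart_zero) (hL0 0)
  have : A x = L x := by
    change L x⁺ - L x⁻ = L x
    rw [posPart_of_nonneg hx, negPart_of_nonneg hx, hz, sub_zero]
  change Tendsto _ _ (𝓝 (A x))
  rw [this]
  exact hL' x hx

namespace IsBandProjection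

variable {u : X} {P : X →L[ℝ] X}

lemma isPositiveMap (hP : IsBandProjection u P) (hu : 0 ≤ u) : IsPositiveMap P := fun x hx =>
  ge_of_tendsto' (hP x hx) fun n => le_inf hx (nsmul_nonneg hu n)

lemma apply_le (hP : IsBandProjection u P) {x : X} (hx : 0 ≤ x) : P x ≤ x :=
  le_of_tendsto' (hP x hx) fun _ => inf_le_left

lemma inf_le_apply (hP : IsBandProjection u P) (hu : 0 ≤ u) {x : X} (hx : 0 ≤ x) :
    x ⊓ u ≤ P x := by
  simpa using (monotone_inf_nsmul x hu).ge_of_tendsto (hP x hx) 1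

omit [HasSolidNorm X] in
/-- A functional which is nonnegative on `[0, u]` is nonnegative on the positive part of the band
generated by `u`. -/
lemma comp_isPositiveMap [IsOrderedModule ℝ X] (hP : IsBandProjection u P) (hu : 0 ≤ u)
    {f : X →L[ℝ] ℝ} (hf : ∀ v, 0 ≤ v → v ≤ u → 0 ≤ f v) : IsPositiveMap (f.comp P) := by
  intro x hx
  refine ge_of_tendsto ((f.continuous.tendsto _).comp (hP x hx)) ?_
  filter_upwards [Ici_mem_atTop 1] with n hn
  have hn0 : (0 : ℝ) < n := by exact_mod_cast (Nat.lt_of_lt_of_le one_pos hn)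
  have hinv : 0 ≤ (n : ℝ)⁻¹ := (inv_pos.2 hn0).le
  have := hf ((n : ℝ)⁻¹ • (x ⊓ n • u)) (smul_nonneg hinv (le_inf hx (nsmul_nonneg hu n)))
    ((smul_le_smul_of_nonneg_left inf_le_right hinv).trans_eq (by
      rw [← Nat.cast_smul_eq_nsmul ℝ, inv_smul_smul₀ hn0.ne']))
  rw [map_smul, smul_eq_mul] at this
  exact nonneg_of_mul_nonneg_right this (inv_pos.2 hn0)

/-- The projection onto the band of a part `u` of `z⁺` does not see `z⁻`. -/
lemma le_apply_of_le_posPart (hP : IsBandProjection u P) (hu : 0 ≤ u) {z : X} (huz : u ≤ z⁺) :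
    u ≤ P z := by
  have h0 : u ⊓ z⁻ = 0 := le_antisymm
    ((inf_le_inf huz le_rfl).trans_eq (posPart_inf_negPart_eq_zero z))
    (le_inf hu (negPart_nonneg z))
  have h1 : P z⁻ = 0 := by
    refine tendsto_nhds_unique (hP _ (negPart_nonneg z)) ?_
    simp only [inf_comm z⁻, nsmul_inf_eq_zero hu (negPart_nonneg z) h0, tendsto_const_nhds]
  have h2 := hP.inf_le_apply hu (posPart_nonneg z)
  rwa [inf_eq_right.2 huz, ← sub_zero (P z⁺), ← h1, ← map_sub, posPart_sub_negPart] at h2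

lemma sum_apply_le {ι : Type*} {u : ι → X} {P : ι → X →L[ℝ] X}
    (hP : ∀ i, IsBandProjection (u i) (P i)) (hu : ∀ i, 0 ≤ u i)
    (hd : ∀ i j, i ≠ j → u i ⊓ u j = 0) (s : Finset ι) {x : X} (hx : 0 ≤ x) :
    ∑ i ∈ s, P i x ≤ x := by
  refine le_of_tendsto' (tendsto_finsetSum s fun i _ => hP i x hx) fun n => ?_
  refine sum_le_of_pairwise_inf_eq_zero s hx (fun i => le_inf hx (nsmul_nonneg (hu i) n))
    (fun i => inf_le_left) fun i j hij => ?_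
  refine le_antisymm ((inf_le_inf inf_le_right inf_le_right).trans_eq ?_)
    (le_inf (le_inf hx (nsmul_nonneg (hu i) n)) (le_inf hx (nsmul_nonneg (hu j) n)))
  refine nsmul_inf_eq_zero (hu i) (nsmul_nonneg (hu j) n) ?_ n
  rw [inf_comm]
  exact nsmul_inf_eq_zero (hu j) (hu i) (by rw [inf_comm]; exact hd i j hij) n

end IsBandProjection

end BandProjection

/-! ### Weak compactness of order intervals -/

section OrderInterval

variable {X : Type*} [NormedAddCommGroup X] [NormedSpace ℝ X] [CompleteSpace X] [Lattice X]
  [IsOrderedAddMonoid X] [IsOrderedModule ℝ X] [HasSolidNorm X]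

omit [IsOrderedModule ℝ X] in
/-- Two functionals which are strictly positive on `(0, u]` are, up to a factor arbitrarily close
to `1`, proportional on some interval `[0, v]` below `u`: take `b` to be the supremum of the
ratio `g / f` over a small interval on which it is bounded. -/
lemma exists_almost_proportional (hX : IsOrderContinuous X) {f g : X →L[ℝ] ℝ} {u : X} (hu : 0 ≤ u)
    (hu0 : u ≠ 0) (hf : ∀ v, 0 ≤ v → v ≤ u → v ≠ 0 → 0 < f v)
    (hg : ∀ v, 0 ≤ v → v ≤ u → v ≠ 0 → 0 < g v) {r : ℝ} (hr1 : r < 1) :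
    ∃ b v, 0 < b ∧ 0 ≤ v ∧ v ≤ u ∧ v ≠ 0 ∧
      ∀ w, 0 ≤ w → w ≤ v → r * b * f w ≤ g w ∧ g w ≤ b * f w := by
  have hfu := hf u hu le_rfl hu0
  obtain ⟨t, ht⟩ := exists_gt (g u / f u)
  rw [div_lt_iff₀ hfu] at ht
  obtain ⟨v₁, hv₁0, hv₁u, hv₁, hv₁pos⟩ := exists_hahn_element hX (t • f - g) hu
  have ev : ∀ (s : ℝ) w, (s • f - g) w = s * f w - g w := fun _ _ => rfl
  have hv₁ne : v₁ ≠ 0 := by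
    rintro rfl
    rw [map_zero, ev] at hv₁
    linarith
  let S : Set ℝ := {q | ∃ w, 0 ≤ w ∧ w ≤ v₁ ∧ w ≠ 0 ∧ q = g w / f w}
  have hSne : S.Nonempty := ⟨_, v₁, hv₁0, le_rfl, hv₁ne, rfl⟩
  have hSbdd : BddAbove S := by
    refine ⟨t, ?_⟩
    rintro _ ⟨w, hw0, hw, hwne, rfl⟩
    have h1 := hv₁pos w hw0 hw hwne
    rw [ev] at h1
    rw [div_le_iff₀ (hf w hw0 (hw.trans hv₁u) hwne)]
    linarith
  have hbpos : 0 < sSup S :=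
    (div_pos (hg v₁ hv₁0 hv₁u hv₁ne) (hf v₁ hv₁0 hv₁u hv₁ne)).trans_le
      (le_csSup hSbdd ⟨v₁, hv₁0, le_rfl, hv₁ne, rfl⟩)
  have hlt : r * sSup S < sSup S := by nlinarith
  obtain ⟨_, ⟨w, hw0, hw, hwne, rfl⟩, hrw⟩ := exists_lt_of_lt_csSup hSne hlt
  rw [lt_div_iff₀ (hf w hw0 (hw.trans hv₁u) hwne)] at hrw
  obtain ⟨v, hv0, hvw, hv, hvpos⟩ := exists_hahn_element hX (g - (r * sSup S) • f) hw0
  have ev' : ∀ (s : ℝ) w, (g - s • f) w = g w - s * f w := fun _ _ => rfl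
  have hvne : v ≠ 0 := by
    rintro rfl
    rw [map_zero, ev'] at hv
    linarith
  refine ⟨sSup S, v, hbpos, hv0, hvw.trans (hw.trans hv₁u), hvne, fun x hx0 hx => ?_⟩
  by_cases hxne : x = 0
  · simp [hxne]
  · have hxv₁ := hx.trans (hvw.trans hw)
    have h1 := hvpos x hx0 hx hxne
    rw [ev'] at h1
    refine ⟨by linarith, ?_⟩
    rw [← div_le_iff₀ (hf x hx0 (hxv₁.trans hv₁u) hxne)]
    exact le_csSup hSbdd ⟨x, hx0, hxv₁, hxne, rfl⟩

/-- A nonzero element `ψ` of the bidual with `0 ≤ ψ ≤ e`, `e ∈ X`, dominates a nonzero positive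
element of `X`. On a part `Q` of `X` the inequality `ε * f (R e) ≤ ψ (f ∘ R)` holds for a single
functional `f`; since every other functional is locally almost proportional to `f`, it holds for
all of them. -/
lemma exists_pos_le_of_bidual (hX : IsOrderContinuous X) {e : X} (he : 0 ≤ e)
    (ψ : (X →L[ℝ] ℝ) →ₗ[ℝ] ℝ) (hψ0 : ∀ f, IsPositiveMap f → 0 ≤ ψ f)
    (hψe : ∀ f, IsPositiveMap f → ψ f ≤ f e) {f : X →L[ℝ] ℝ} (hf : IsPositiveMap f)
    (hψf : 0 < ψ f) : ∃ y, 0 ≤ y ∧ y ≠ 0 ∧ ∀ g, IsPositiveMap g → g y ≤ ψ g := by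
  -- `ψ (g ∘ ·)` and `g (· e)` as additive functions of an operator
  let Ψ : (X →L[ℝ] ℝ) → (X →L[ℝ] X) →+ ℝ := fun g =>
    { toFun := fun R => ψ (g.comp R)
      map_zero' := by simp
      map_add' := fun R S => by rw [ContinuousLinearMap.comp_add, map_add] }
  let E : (X →L[ℝ] ℝ) → (X →L[ℝ] X) →+ ℝ := fun g =>
    { toFun := fun R => g (R e)
      map_zero' := by simp
      map_add' := fun R S => by simp }
  have hE : ∀ (g : X →L[ℝ] ℝ) (R : X →L[ℝ] X), |g (R e)| ≤ ‖g‖ * ‖R e‖ := fun g R =>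
    g.le_opNorm _
  have hΨ : ∀ g, IsPositiveMap g → ∀ R : X →L[ℝ] X, IsPositiveMap R →
      |ψ (g.comp R)| ≤ ‖g‖ * ‖R e‖ := fun g hg R hR => by
    rw [abs_of_nonneg (hψ0 _ (hg.comp hR))]
    exact (hψe _ (hg.comp hR)).trans ((le_abs_self _).trans (g.le_opNorm _))
  have hψmono : ∀ g h : X →L[ℝ] ℝ, IsPositiveMap (h - g) → ψ g ≤ ψ h := fun g h hgh => by
    have := hψ0 _ hgh
    rwa [map_sub, sub_nonneg] at this
  have hfe : 0 < f e := hψf.trans_le (hψe f hf)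
  obtain ⟨ε, hε0, hεlt⟩ : ∃ ε : ℝ, 0 < ε ∧ ε * f e < ψ f := by
    obtain ⟨ε, h0, h1⟩ := exists_between (div_pos hψf hfe)
    exact ⟨ε, h0, (lt_div_iff₀ hfe).1 h1⟩
  let μ : (X →L[ℝ] X) →+ ℝ := Ψ f - ε • E f
  have hμ : ∀ R, μ R = ψ (f.comp R) - ε * f (R e) := fun R => rfl
  have hid : IsPositiveMap (ContinuousLinearMap.id ℝ X) := fun x hx => hx
  obtain ⟨Q, hQ, hQ1, hμQ, hQpos⟩ := exists_hahn_operator hX μ (e := e) (C := ‖f‖ + ε * ‖f‖)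
    (fun R hR => by
      rw [hμ]
      refine (abs_sub _ _).trans ?_
      rw [abs_mul, abs_of_pos hε0, add_mul, mul_assoc]
      exact add_le_add (hΨ f hf R hR) (mul_le_mul_of_nonneg_left (hE f R) hε0.le)) hid
  have hQe : Q e ≠ 0 := by
    intro h0
    have h1 : 0 < μ Q := by
      refine lt_of_lt_of_le ?_ hμQ
      rw [hμ, ContinuousLinearMap.comp_id, ContinuousLinearMap.id_apply]
      linarith
    rw [hμ, h0, map_zero, mul_zero, sub_zero] at h1
    have := hΨ f hf Q hQ
    rw [h0, norm_zero, mul_zero] at this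
    exact absurd (le_antisymm this (abs_nonneg _)) (abs_pos.2 h1.ne').ne'
  refine ⟨ε • Q e, smul_nonneg hε0.le (hQ e he), smul_ne_zero hε0.ne' hQe, fun g hg => ?_⟩
  rw [map_smul, smul_eq_mul]
  by_contra hlt
  rw [not_le] at hlt
  have hψgQ : ψ (g.comp Q) ≤ ψ g := hψmono _ _ fun x hx => by
    have := hg _ (hQ1 x hx)
    simpa using this
  have hgQe : 0 < g (Q e) := pos_of_mul_pos_right ((hψ0 g hg).trans_lt hlt) hε0.le
  -- pass to `r * ε` with `r < 1` to have room for the approximation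
  obtain ⟨r, hr0, hr1, hrlt⟩ : ∃ r : ℝ, 0 < r ∧ r < 1 ∧ ψ (g.comp Q) < r * ε * g (Q e) := by
    have hpos : 0 < ε * g (Q e) := mul_pos hε0 hgQe
    obtain ⟨r, h0, h1⟩ := exists_between ((div_lt_one hpos).2 (hψgQ.trans_lt hlt))
    refine ⟨r, (div_nonneg (hψ0 _ (hg.comp hQ)) hpos.le).trans_lt h0, h1, ?_⟩
    rw [mul_assoc]
    exact (div_lt_iff₀ hpos).1 h0
  have hrε : 0 < r * ε := mul_pos hr0 hε0
  let χ : (X →L[ℝ] X) →+ ℝ := (r * ε) • E g - Ψ g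
  have hχ : ∀ R, χ R = r * ε * g (R e) - ψ (g.comp R) := fun R => rfl
  obtain ⟨Q', hQ', hQ'Q, hχQ', hQ'pos⟩ := exists_hahn_operator hX χ (e := e)
    (C := r * ε * ‖g‖ + ‖g‖)
    (fun R hR => by
      rw [hχ]
      refine (abs_sub _ _).trans ?_
      rw [abs_mul, abs_of_pos hrε, add_mul, mul_assoc (r * ε) ‖g‖]
      exact add_le_add (mul_le_mul_of_nonneg_left (hE g R) hrε.le) (hΨ g hg R hR)) hQ
  have hχQ'0 : 0 < χ Q' := by
    refine lt_of_lt_of_le ?_ hχQ'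
    rw [hχ]
    linarith
  set u := Q' e with hu_def
  have hu : 0 ≤ u := hQ' e he
  have hu0 : u ≠ 0 := by
    intro h0
    rw [hχ, ← hu_def, h0, map_zero, mul_zero, zero_sub] at hχQ'0
    linarith [hψ0 _ (hg.comp hQ')]
  -- band projections of `Q'` are nonzero operators below `Q'`
  have key : ∀ v, 0 ≤ v → v ≤ u → v ≠ 0 → ∀ P, IsBandProjection v P →
      IsPositiveMap (P.comp Q') ∧ ε * f (P u) < ψ (f.comp (P.comp Q')) ∧
        ψ (g.comp (P.comp Q')) < r * ε * g (P u) := by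
    intro v hv0 hvu hvne P hP
    have h1 : IsPositiveMap (P.comp Q') := (hP.isPositiveMap hv0).comp hQ'
    have h2 : IsPositiveMap (Q' - P.comp Q') := fun x hx =>
      sub_nonneg.2 (hP.apply_le (hQ' x hx))
    have h3 : IsPositiveMap (Q - P.comp Q') := fun x hx => by
      have := add_nonneg (h2 x hx) (hQ'Q x hx)
      simpa using this
    have h4 : P.comp Q' ≠ 0 := by
      intro h
      have h5 : P u = 0 := congrArg (fun T : X →L[ℝ] X => T e) h
      have h6 := hP.inf_le_apply hv0 hu
      rw [h5, inf_eq_right.2 hvu] at h6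
      exact hvne (le_antisymm h6 hv0)
    have h5 := hQpos _ h1 h3 h4
    have h6 := hQ'pos _ h1 h2 h4
    rw [hμ] at h5
    rw [hχ] at h6
    exact ⟨h1, by simpa using h5, by simpa using h6⟩
  -- a positive functional vanishing at `v` vanishes on the band of `v`
  have hnull : ∀ (h : X →L[ℝ] ℝ), IsPositiveMap h → ∀ v, 0 ≤ v → h v = 0 →
      ∀ P, IsBandProjection v P → h (P u) = 0 := by
    intro h hh v hv0 hv P hP
    refine le_antisymm ?_ (hh _ (hP.isPositiveMap hv0 u hu))
    refine le_of_tendsto' ((h.continuous.tendsto _).comp (hP u hu)) fun n => ?_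
    refine (hh.mono inf_le_right).trans_eq ?_
    rw [map_nsmul, hv, nsmul_zero]
  -- `f` and `g` are strictly positive on `(0, u]`
  have hfpos : ∀ v, 0 ≤ v → v ≤ u → v ≠ 0 → 0 < f v := by
    intro v hv0 hvu hvne
    refine lt_of_le_of_ne (hf v hv0) fun h0 => ?_
    obtain ⟨P, hP⟩ := exists_isBandProjection hX hv0
    obtain ⟨h1, h2, -⟩ := key v hv0 hvu hvne P hP
    have h3 := hψe _ (hf.comp h1)
    rw [ContinuousLinearMap.comp_apply, ContinuousLinearMap.comp_apply, ← hu_def] at h3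
    rw [hnull f hf v hv0 h0.symm P hP] at h2 h3
    linarith
  have hgpos : ∀ v, 0 ≤ v → v ≤ u → v ≠ 0 → 0 < g v := by
    intro v hv0 hvu hvne
    refine lt_of_le_of_ne (hg v hv0) fun h0 => ?_
    obtain ⟨P, hP⟩ := exists_isBandProjection hX hv0
    obtain ⟨h1, -, h2⟩ := key v hv0 hvu hvne P hP
    rw [hnull g hg v hv0 h0.symm P hP] at h2
    linarith [hψ0 _ (hg.comp h1)]
  -- on the band of `v`: `r * b * f ≤ g ≤ b * f`, which makes the strict inequalities of `key` for
  -- `f` and for `g` contradict each other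
  obtain ⟨b, v, hb, hv0, hvu, hvne, hv⟩ :=
    exists_almost_proportional hX hu hu0 hfpos hgpos hr1
  obtain ⟨P, hP⟩ := exists_isBandProjection hX hv0
  obtain ⟨h1, h2, h3⟩ := key v hv0 hvu hvne P hP
  have hlow : IsPositiveMap ((g - (r * b) • f).comp P) :=
    hP.comp_isPositiveMap hv0 fun w hw0 hw => sub_nonneg.2 (hv w hw0 hw).1
  have hupp : IsPositiveMap ((b • f - g).comp P) :=
    hP.comp_isPositiveMap hv0 fun w hw0 hw => sub_nonneg.2 (hv w hw0 hw).2
  have h4 : r * b * ψ (f.comp (P.comp Q')) ≤ ψ (g.comp (P.comp Q')) := by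
    rw [← smul_eq_mul, ← map_smul]
    refine hψmono _ _ fun x hx => ?_
    exact hlow _ (hQ' x hx)
  have h5 : g (P u) ≤ b * f (P u) := sub_nonneg.1 (hupp u hu)
  have h6 : r * b * (ε * f (P u)) < r * b * ψ (f.comp (P.comp Q')) :=
    mul_lt_mul_of_pos_left h2 (mul_pos hr0 hb)
  have h7 := mul_le_mul_of_nonneg_left h5 hrε.le
  linarith [mul_assoc r ε (b * f (P u))]

/-- An element `φ` of the bidual with `0 ≤ φ ≤ e`, `e ∈ X`, belongs to `X`: a maximal `x ∈ X`
with `0 ≤ x ≤ φ` has to equal `φ`. -/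
lemma exists_eq_of_bidual (hX : IsOrderContinuous X) {e : X}
    (φ : (X →L[ℝ] ℝ) →ₗ[ℝ] ℝ) (hφ0 : ∀ f, IsPositiveMap f → 0 ≤ φ f)
    (hφe : ∀ f, IsPositiveMap f → φ f ≤ f e) :
    ∃ x, 0 ≤ x ∧ x ≤ e ∧ ∀ f, φ f = f x := by
  have hle : ∀ y, (∀ f : X →L[ℝ] ℝ, IsPositiveMap f → f y ≤ φ f) → y ≤ e := fun y hy => by
    refine sub_nonneg.1 (nonneg_of_forall_positive fun f hf => ?_)
    rw [map_sub, sub_nonneg]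
    exact (hy f hf).trans (hφe f hf)
  obtain ⟨x, hx0, hmax⟩ := zorn_le_nonempty₀
    {y : X | 0 ≤ y ∧ ∀ f : X →L[ℝ] ℝ, IsPositiveMap f → f y ≤ φ f}
    (fun c hcs hc y hy => by
      have : Nonempty c := ⟨⟨y, hy⟩⟩
      have : IsDirectedOrder c := ⟨hc.directed⟩
      have hmono : Monotone ((↑) : c → X) := Subtype.mono_coe c
      obtain ⟨s, hs⟩ := exists_tendsto_of_monotone hX hmono fun i => hle _ (hcs i.2).2
      refine ⟨s, ⟨ge_of_tendsto' hs fun i => (hcs i.2).1, fun f hf => ?_⟩,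
        fun z hz => hmono.ge_of_tendsto hs ⟨z, hz⟩⟩
      exact le_of_tendsto' ((f.continuous.tendsto s).comp hs) fun i => (hcs i.2).2 f hf)
    0 ⟨le_rfl, fun f hf => by rw [map_zero]; exact hφ0 f hf⟩
  have hxm := hmax.prop
  refine ⟨x, hx0, hle x hxm.2, ?_⟩
  have he : 0 ≤ e := hx0.trans (hle x hxm.2)
  let ev : (X →L[ℝ] ℝ) →ₗ[ℝ] ℝ :=
    { toFun := fun f => f x
      map_add' := fun _ _ => rfl
      map_smul' := fun _ _ => rfl }
  have hpos : ∀ f, IsPositiveMap f → φ f = f x := by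
    intro f hf
    by_contra hne
    have hlt : 0 < (φ - ev) f := sub_pos.2 (lt_of_le_of_ne (hxm.2 f hf) (Ne.symm hne))
    obtain ⟨y, hy0, hyne, hy⟩ := exists_pos_le_of_bidual hX he (φ - ev)
      (fun g hg => sub_nonneg.2 (hxm.2 g hg))
      (fun g hg => (sub_le_self _ (hg x hx0)).trans (hφe g hg)) hf hlt
    have h1 := hmax.le_of_ge (y := x + y) ⟨add_nonneg hx0 hy0, fun g hg => by
      rw [map_add]
      have h2 : g y ≤ φ g - g x := hy g hg
      linarith⟩ (le_add_of_nonneg_right hy0)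
    exact hyne (le_antisymm (by simpa using h1) hy0)
  intro f
  obtain ⟨g, h, hg, hh, rfl⟩ := exists_positive_sub_positive f
  rw [map_sub, hpos g hg, hpos h hh]
  rfl

/-- Order intervals are weakly compact, in terms of ultrafilters. -/
lemma exists_weak_limit_of_Icc (hX : IsOrderContinuous X) {e : X} (U : Ultrafilter X)
    (hU : Icc 0 e ∈ U) : ∃ x ∈ Icc 0 e, ∀ f : X →L[ℝ] ℝ, Tendsto f U (𝓝 (f x)) := by
  have hlim : ∀ f : X →L[ℝ] ℝ, ∃ t : ℝ, Tendsto f U (𝓝 t) := by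
    intro f
    have hmem : Metric.closedBall (0 : ℝ) (‖f‖ * ‖e‖) ∈ U.map f := by
      refine Ultrafilter.mem_map.2 (mem_of_superset hU fun y hy => ?_)
      rw [mem_preimage, mem_closedBall_zero_iff]
      exact (f.le_opNorm y).trans (mul_le_mul_of_nonneg_left
        (norm_le_norm_of_nonneg_of_le hy.1 hy.2) (norm_nonneg _))
    obtain ⟨t, -, ht⟩ := isCompact_iff_ultrafilter_le_nhds.1
      (isCompact_closedBall (0 : ℝ) (‖f‖ * ‖e‖)) (U.map f) (le_principal_iff.2 hmem)
    exact ⟨t, ht⟩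
  choose φ hφ using hlim
  let Φ : (X →L[ℝ] ℝ) →ₗ[ℝ] ℝ :=
    { toFun := φ
      map_add' := fun f g => tendsto_nhds_unique (hφ (f + g)) ((hφ f).add (hφ g))
      map_smul' := fun c f => tendsto_nhds_unique (hφ (c • f)) ((hφ f).const_mul c) }
  obtain ⟨x, hx0, hxe, hx⟩ := exists_eq_of_bidual hX (e := e) Φ
    (fun f hf => ge_of_tendsto (hφ f) (mem_of_superset hU fun y hy => hf y hy.1))
    (fun f hf => le_of_tendsto (hφ f) (mem_of_superset hU fun y hy => hf.mono hy.2))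
  exact ⟨x, ⟨hx0, hxe⟩, fun f => hx f ▸ hφ f⟩

end OrderInterval

/-! ### Disjoint sequences below a weakly precompact set -/

section Schur

/-- The combinatorial core of the Schur property of `ℓ¹`: if the rows of `a` are absolutely summable
and their sums over every set of columns form a Cauchy sequence, then the diagonal is not bounded
away from `0`. By Baire's theorem on `ℕ → Bool` these sequences of sums are, near some `c₀`,
uniformly Cauchy; changing one far away digit of `c₀` compares the entries of a column. -/
lemma exists_abs_diagonal_lt (a : ℕ → ℕ → ℝ) (ha : ∀ k, Summable fun n => |a k n|)
    (hcauchy : ∀ c : ℕ → Bool, CauchySeq fun k => ∑' n, if c n then a k n else 0)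
    {δ : ℝ} (hδ : 0 < δ) : ∃ n, |a n n| < δ := by
  let F : ℕ → (ℕ → Bool) → ℝ := fun k c => ∑' n, if c n then a k n else 0
  have hterm : ∀ k (c : ℕ → Bool) n, ‖(if c n then a k n else 0)‖ ≤ |a k n| := by
    intro k c n
    split_ifs
    · exact le_rfl
    · simp
  have hsum : ∀ k (c : ℕ → Bool), Summable fun n => if c n then a k n else 0 := fun k c =>
    (ha k).of_norm_bounded (hterm k c)
  have hF : ∀ k, Continuous (F k) := by
    intro k
    refine continuous_tsum (fun n => ?_) (ha k) fun n c => hterm k c n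
    exact (continuous_of_discreteTopology (f := fun b : Bool => if b then a k n else 0)).comp
      (continuous_apply n)
  let E : ℕ → Set (ℕ → Bool) := fun N =>
    {c | ∀ k, N ≤ k → ∀ l, N ≤ l → |F k c - F l c| ≤ δ / 8}
  have hE : ∀ N, IsClosed (E N) := by
    intro N
    have : E N = ⋂ k, ⋂ (_ : N ≤ k), ⋂ l, ⋂ (_ : N ≤ l), {c | |F k c - F l c| ≤ δ / 8} := by
      ext c
      simp [E]
    rw [this]
    exact isClosed_iInter fun k => isClosed_iInter fun _ => isClosed_iInter fun l =>
      isClosed_iInter fun _ => isClosed_le ((hF k).sub (hF l)).abs continuous_const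
  have hcover : ⋃ N, E N = univ := by
    refine eq_univ_of_forall fun c => mem_iUnion.2 ?_
    obtain ⟨N, hN⟩ := Metric.cauchySeq_iff.1 (hcauchy c) (δ / 8) (by positivity)
    exact ⟨N, fun k hk l hl => (hN k hk l hl).le⟩
  obtain ⟨N, c₀, hc₀⟩ := nonempty_interior_of_iUnion_of_closed hE hcover
  let c : ℕ → ℕ → Bool := fun n => Function.update c₀ n (!c₀ n)
  have hc : Tendsto c atTop (𝓝 c₀) := by
    refine tendsto_pi_nhds.2 fun m => tendsto_const_nhds.congr' ?_
    filter_upwards [eventually_gt_atTop m] with n hn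
    exact (Function.update_of_ne hn.ne _ _).symm
  have hdiff : ∀ n, ∃ s : ℝ, |s| = 1 ∧ ∀ k, F k (c n) - F k c₀ = s * a k n := by
    intro n
    have h : ∀ k, F k (c n) - F k c₀ =
        (if c n n then a k n else 0) - (if c₀ n then a k n else 0) := by
      intro k
      rw [← (hsum k _).tsum_sub (hsum k _)]
      refine tsum_eq_single n fun m hm => ?_
      rw [show c n m = c₀ m from Function.update_of_ne hm _ _, sub_self]
    have hcn : c n n = !c₀ n := Function.update_self _ _ _
    cases h0 : c₀ n with
    | true => exact ⟨-1, by simp, fun k => by rw [h, hcn, h0]; simp⟩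
    | false => exact ⟨1, by simp, fun k => by rw [h, hcn, h0]; simp⟩
  have hN0 : Tendsto (fun n => |a N n|) atTop (𝓝 0) := (ha N).tendsto_atTop_zero
  obtain ⟨n, hn1, hn2, hn3⟩ := ((hc.eventually (mem_interior_iff_mem_nhds.1 hc₀)).and
    ((hN0.eventually (gt_mem_nhds (half_pos hδ))).and (eventually_ge_atTop N))).exists
  refine ⟨n, ?_⟩
  obtain ⟨s, hs, hsk⟩ := hdiff n
  have h1 : |F n (c n) - F N (c n)| ≤ δ / 8 := hn1 n hn3 N le_rfl
  have h2 : |F n c₀ - F N c₀| ≤ δ / 8 := interior_subset hc₀ n hn3 N le_rfl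
  have h3 : |a n n - a N n| ≤ δ / 4 := by
    calc |a n n - a N n| = |s * (a n n - a N n)| := by rw [abs_mul, hs, one_mul]
      _ = |(F n (c n) - F N (c n)) - (F n c₀ - F N c₀)| := by
        rw [mul_sub, ← hsk, ← hsk]
        congr 1
        ring
      _ ≤ δ / 8 + δ / 8 := (abs_sub _ _).trans (add_le_add h1 h2)
      _ = δ / 4 := by ring
  have h4 := abs_add_le (a n n - a N n) (a N n)
  rw [sub_add_cancel] at h4
  linarith

end Schur

section DisjointSequence

variable {X : Type*} [NormedAddCommGroup X] [NormedSpace ℝ X] [CompleteSpace X] [Lattice X]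
  [IsOrderedAddMonoid X] [HasSolidNorm X]

/-- A disjoint sequence of positive elements below the positive parts of elements of `K ∪ -K`,
for a weakly precompact set `K`, has no subsequence on which some positive functional is bounded
away from `0`, that is, it is weakly null. The band projections onto the bands of the sequence,
followed by `± f`, are the coordinates of an operator into `ℓ¹`. -/
lemma exists_apply_lt_of_disjoint (hX : IsOrderContinuous X) {K : Set X}
    (hK : IsWeaklyPrecompact K) {e : ℕ → X} (he : ∀ n, 0 ≤ e n)
    (hd : ∀ m n, m ≠ n → e m ⊓ e n = 0) (heK : ∀ n, ∃ x ∈ K, e n ≤ x⁺ ∨ e n ≤ (-x)⁺)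
    {f : X →L[ℝ] ℝ} (hf : IsPositiveMap f) {δ : ℝ} (hδ : 0 < δ) : ∃ n, f (e n) < δ := by
  have hsign : ∀ n, ∃ x ∈ K, ∃ s : ℝ, |s| = 1 ∧ e n ≤ (s • x)⁺ := by
    intro n
    obtain ⟨x, hx, h | h⟩ := heK n
    · exact ⟨x, hx, 1, by simp, by rwa [one_smul]⟩
    · exact ⟨x, hx, -1, by simp, by rwa [neg_smul, one_smul]⟩
  choose x hxK s hs hex using hsign
  obtain ⟨φ, hφ, hcauchy⟩ := hK x hxK
  have hP : ∀ n, ∃ P, IsBandProjection (e (φ n)) P := fun n =>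
    exists_isBandProjection hX (he (φ n))
  choose P hP using hP
  have hPd : ∀ m n, m ≠ n → e (φ m) ⊓ e (φ n) = 0 := fun m n h => hd _ _ (hφ.injective.ne h)
  let h : ℕ → X →L[ℝ] ℝ := fun n => s (φ n) • f.comp (P n)
  have hh : ∀ n y, |h n y| ≤ f (P n |y|) := by
    intro n y
    change |s (φ n) * f (P n y)| ≤ _
    rw [abs_mul, hs, one_mul]
    exact (hf.comp ((hP n).isPositiveMap (he _))).abs_apply_le y
  have hpart : ∀ y (t : Finset ℕ), ∑ n ∈ t, |h n y| ≤ f |y| := by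
    intro y t
    refine (Finset.sum_le_sum fun n _ => hh n y).trans ?_
    rw [← map_sum]
    exact hf.mono (IsBandProjection.sum_apply_le hP (fun n => he _) hPd t (abs_nonneg y))
  have hsum : ∀ y, Summable fun n => |h n y| := fun y =>
    summable_of_sum_le (fun n => abs_nonneg _) (hpart y)
  have hterm : ∀ (c : ℕ → Bool) y n, ‖(if c n then h n y else 0)‖ ≤ |h n y| := by
    intro c y n
    split_ifs
    · exact le_rfl
    · simp
  have hsum' : ∀ (c : ℕ → Bool) y, Summable fun n => if c n then h n y else 0 := fun c y =>
    (hsum y).of_norm_bounded (hterm c y)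
  obtain ⟨n, hn⟩ := exists_abs_diagonal_lt (fun k n => h n (x (φ k))) (fun k => hsum _)
    (fun c => by
      let H : X →ₗ[ℝ] ℝ :=
        { toFun := fun y => ∑' n, if c n then h n y else 0
          map_add' := fun y z => by
            rw [← (hsum' c y).tsum_add (hsum' c z)]
            refine tsum_congr fun n => ?_
            split_ifs <;> simp
          map_smul' := fun r y => by
            rw [RingHom.id_apply, smul_eq_mul, ← tsum_mul_left]
            refine tsum_congr fun n => ?_
            split_ifs <;> simp }
      exact hcauchy (H.mkContinuous ‖f‖ fun y => by
        refine (tsum_of_norm_bounded (hsum y).hasSum (hterm c y)).trans ?_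
        refine ((hsum y).tsum_le_of_sum_le (hpart y)).trans ?_
        rw [← norm_abs_eq_norm y]
        exact (le_abs_self _).trans (f.le_opNorm _))) hδ
  refine ⟨φ n, lt_of_le_of_lt ?_ hn⟩
  refine le_trans ?_ (le_abs_self _)
  change f (e (φ n)) ≤ s (φ n) * f (P n (x (φ n)))
  rw [← smul_eq_mul, ← map_smul, ← map_smul]
  exact hf.mono ((hP n).le_apply_of_le_posPart (he _) (hex _))

end DisjointSequence

/-! ### The weak topology -/

section WeakTopology

variable {X : Type*} [NormedAddCommGroup X] [NormedSpace ℝ X]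

lemma isWeaklyCompact_of_ultrafilter {K : Set X}
    (h : ∀ U : Ultrafilter X, K ∈ U → ∃ x ∈ K, ∀ f : X →L[ℝ] ℝ, Tendsto f U (𝓝 (f x))) :
    IsWeaklyCompact K := by
  refine isCompact_iff_ultrafilter_le_nhds.2 fun U hU => ?_
  obtain ⟨x, hx, hlim⟩ := h (U.map (toWeakSpace ℝ X).symm) (by
    refine Ultrafilter.mem_map.2 (mem_of_superset (le_principal_iff.1 hU) ?_)
    rintro _ ⟨y, hy, rfl⟩
    simpa using hy)
  refine ⟨toWeakSpace ℝ X x, mem_image_of_mem _ hx, ?_⟩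
  have hind : IsInducing fun (y : WeakSpace ℝ X) (f : X →L[ℝ] ℝ) =>
      (topDualPairing ℝ X).flip y f := ⟨rfl⟩
  exact (hind.tendsto_nhds_iff (f := id)).2 (tendsto_pi_nhds.2 fun f => hlim f)

lemma continuous_apply_toWeakSpace_symm (f : X →L[ℝ] ℝ) :
    Continuous fun y : WeakSpace ℝ X => f ((toWeakSpace ℝ X).symm y) :=
  WeakBilin.eval_continuous (topDualPairing ℝ X).flip f

/-- Weakly compact sets are weakly precompact (the easy half of the Eberlein-Šmulian theorem): in
the closed span of a sequence countably many functionals separate the points, so the part of the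
weakly compact set in this closed span is weakly metrizable. -/
lemma IsWeaklyCompact.isWeaklyPrecompact {K : Set X} (hK : IsWeaklyCompact K) :
    IsWeaklyPrecompact K := by
  intro u hu
  let Y : Submodule ℝ X := (Submodule.span ℝ (range u)).topologicalClosure
  have huY : ∀ n, u n ∈ Y := fun n =>
    Submodule.le_topologicalClosure _ (Submodule.subset_span (mem_range_self n))
  have hYsep : TopologicalSpace.IsSeparable (Y : Set X) := by
    rw [Submodule.topologicalClosure_coe]
    exact (TopologicalSpace.IsSeparable.span (countable_range u).isSeparable).closure
  have : TopologicalSpace.SeparableSpace Y := hYsep.separableSpace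
  let d : ℕ → Y := TopologicalSpace.denseSeq Y
  have hg : ∀ n, ∃ g : X →L[ℝ] ℝ, ‖g‖ ≤ 1 ∧ g (d n) = ‖(d n : X)‖ := fun n => by
    obtain ⟨g, h1, h2⟩ := exists_dual_vector'' ℝ (d n : X)
    exact ⟨g, h1, by simpa using h2⟩
  choose g hg1 hgd using hg
  have hsep : ∀ y ∈ Y, (∀ n, g n y = 0) → y = 0 := by
    intro y hy h0
    refine norm_le_zero_iff.1 (le_of_forall_pos_le_add fun ε hε => ?_)
    obtain ⟨n, hn⟩ := (TopologicalSpace.denseRange_denseSeq Y).exists_dist_lt ⟨y, hy⟩ (half_pos hε)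
    rw [dist_comm] at hn
    have hn' : ‖(d n : X) - y‖ < ε / 2 := by
      rw [← dist_eq_norm]
      exact hn
    have h1 : ‖(d n : X)‖ ≤ ‖(d n : X) - y‖ := by
      rw [← hgd n, ← sub_zero (g n (d n)), ← h0 n, ← map_sub]
      refine (le_abs_self _).trans (((g n).le_opNorm _).trans ?_)
      exact mul_le_of_le_one_left (norm_nonneg _) (hg1 n)
    have h2 : ‖y‖ ≤ ‖(d n : X)‖ + ‖(d n : X) - y‖ := by
      simpa using norm_sub_le (d n : X) ((d n : X) - y)
    linarith
  have hYclosed : IsClosed (toWeakSpace ℝ X '' (Y : Set X)) := by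
    have h1 := (Y.convex (𝕜 := ℝ)).toWeakSpace_closure ℝ
    rw [(Submodule.isClosed_topologicalClosure _).closure_eq] at h1
    rw [h1]
    exact isClosed_closure
  let M : Set (WeakSpace ℝ X) := toWeakSpace ℝ X '' K ∩ toWeakSpace ℝ X '' (Y : Set X)
  have hM : IsCompact M := IsCompact.inter_right hK hYclosed
  have : CompactSpace M := isCompact_iff_compactSpace.1 hM
  have hMsep : ∀ y z : M, y ≠ z →
      ∃ n, g n ((toWeakSpace ℝ X).symm y) ≠ g n ((toWeakSpace ℝ X).symm z) := by
    rintro ⟨_, _, y, hy, rfl⟩ ⟨_, _, z, hz, rfl⟩ hne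
    by_contra! hall
    refine hne (Subtype.ext (congrArg (toWeakSpace ℝ X)
      (sub_eq_zero.1 (hsep _ (Y.sub_mem hy hz) fun n => ?_))))
    rw [map_sub, sub_eq_zero]
    exact hall n
  have : TopologicalSpace.MetrizableSpace M :=
    Metric.PiNatEmbed.TopologicalSpace.MetrizableSpace.of_countable_separating
      (fun n (y : M) => g n ((toWeakSpace ℝ X).symm y))
      (fun n => (continuous_apply_toWeakSpace_symm (g n)).comp continuous_subtype_val)
      fun y z h => hMsep y z h
  obtain ⟨y, φ, hφ, hlim⟩ := CompactSpace.tendsto_subseq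
    (fun n => (⟨toWeakSpace ℝ X (u n), mem_image_of_mem _ (hu n), mem_image_of_mem _ (huY n)⟩ : M))
  refine ⟨φ, hφ, fun f => ?_⟩
  exact ((((continuous_apply_toWeakSpace_symm f).comp continuous_subtype_val).tendsto y).comp
    hlim).cauchySeq

end WeakTopology

/-! ### Disjoint families -/

section DisjointFamily

variable {X : Type*} [NormedAddCommGroup X] [NormedSpace ℝ X] [Lattice X]
  [IsOrderedAddMonoid X] [HasSolidNorm X]

variable [IsOrderedModule ℝ X]

/-- The elements disjoint from `z ≥ 0`. -/
def disjointComplement {z : X} (hz : 0 ≤ z) : Submodule ℝ X where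
  carrier := {x | |x| ⊓ z = 0}
  zero_mem' := by simpa using hz
  add_mem' {x y} hx hy := by
    have h := add_inf_eq_zero (abs_nonneg x) (abs_nonneg y) hz hx hy
    exact le_antisymm ((inf_le_inf (abs_add_le x y) le_rfl).trans h.le)
      (le_inf (abs_nonneg _) hz)
  smul_mem' c x hx := by
    have key : ∀ (r : ℝ) (y : X), 0 ≤ r → y ≤ |x| → r • y ≤ ⌈|r|⌉₊ • |x| := fun r y hr hy => by
      rw [← Nat.cast_smul_eq_nsmul ℝ]
      exact (smul_le_smul_of_nonneg_left hy hr).trans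
        (smul_le_smul_of_nonneg_right ((le_abs_self r).trans (Nat.le_ceil _)) (abs_nonneg x))
    have h : |c • x| ≤ ⌈|c|⌉₊ • |x| := by
      rcases le_total 0 c with hc | hc
      · refine abs_le'.2 ⟨key c x hc (le_abs_self x), ?_⟩
        rw [← smul_neg]
        exact key c (-x) hc (neg_le_abs x)
      · rw [← abs_neg c]
        refine abs_le'.2 ⟨?_, ?_⟩
        · rw [← neg_smul_neg]
          exact key (-c) (-x) (neg_nonneg.2 hc) (neg_le_abs x)
        · rw [← neg_smul]
          exact key (-c) x (neg_nonneg.2 hc) (le_abs_self x)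
    exact le_antisymm ((inf_le_inf h le_rfl).trans (nsmul_inf_eq_zero (abs_nonneg x) hz hx _).le)
      (le_inf (abs_nonneg _) hz)

omit [HasSolidNorm X] in
lemma mem_disjointComplement {z : X} (hz : 0 ≤ z) {x : X} :
    x ∈ disjointComplement hz ↔ |x| ⊓ z = 0 := Iff.rfl

lemma isBand_disjointComplement {z : X} (hz : 0 ≤ z) : IsBand (disjointComplement hz) where
  isClosed := by
    have h : Continuous fun x : X => |x| ⊓ z := by
      simp only [abs]
      fun_prop
    exact isClosed_singleton.preimage h
  solid x y hy hxy :=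
    le_antisymm ((inf_le_inf hxy le_rfl).trans_eq hy) (le_inf (abs_nonneg _) hz)
  sup_mem S x hS hx := by
    rw [mem_disjointComplement, ← posPart_add_negPart]
    refine add_inf_eq_zero (posPart_nonneg x) (negPart_nonneg x) hz ?_ ?_
    · -- `x⁺ - w` is an upper bound of `S`, whence `w ≤ x⁻`
      set w := x⁺ ⊓ z with hw
      have hw0 : 0 ≤ w := le_inf (posPart_nonneg x) hz
      have hub : x⁺ - w ∈ upperBounds S := fun s hs => by
        have h1 : |s| ⊓ w = 0 := le_antisymm
          ((inf_le_inf le_rfl inf_le_right).trans_eq (hS hs)) (le_inf (abs_nonneg _) hw0)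
        have h2 : s⁺ ⊓ w = 0 := le_antisymm
          ((inf_le_inf (sup_le (le_abs_self s) (abs_nonneg s)) le_rfl).trans_eq h1)
          (le_inf (posPart_nonneg _) hw0)
        exact (le_posPart s).trans (le_sub_iff_add_le.2
          (add_le_of_inf_eq_zero h2 (posPart_mono (hx.1 hs)) inf_le_left))
      have h3 : w ≤ x⁻ := by
        have h4 := le_sub_comm.1 (hx.2 hub)
        have h5 : x⁺ - x = x⁻ := by
          nth_rw 2 [← posPart_sub_negPart x]
          exact sub_sub_cancel _ _
        rwa [h5] at h4
      exact le_antisymm ((le_inf inf_le_left h3).trans_eq (posPart_inf_negPart_eq_zero x)) hw0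
    · rcases S.eq_empty_or_nonempty with rfl | ⟨s, hs⟩
      · -- the supremum of the empty set is the least element of `X`, which can only be `0`
        have hbot : ∀ y, x ≤ y := fun y => hx.2 (by simp)
        have hx0 : 0 ≤ x := by
          have := hbot (x + x)
          simpa using this
        rw [negPart_of_nonneg hx0]
        exact inf_eq_left.2 hz
      · refine le_antisymm ((inf_le_inf ?_ le_rfl).trans_eq (hS hs))
          (le_inf (negPart_nonneg _) hz)
        exact (negPart_anti (hx.1 hs)).trans (sup_le (neg_le_abs s) (abs_nonneg s))

/-- A family of positive elements below `K ∪ -K` which is maximal among the disjoint ones is only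
disjoint from `0`, if `K` generates `X` as a band. -/
lemma exists_maximal_disjoint_family {K : Set X} (hK : bandGenerated K = ⊤) :
    ∃ E : Set X, (∀ e ∈ E, 0 ≤ e ∧ ∃ x ∈ K, e ≤ x⁺ ∨ e ≤ (-x)⁺) ∧
      (∀ e ∈ E, ∀ e' ∈ E, e ≠ e' → e ⊓ e' = 0) ∧
      ∀ z, 0 ≤ z → (∀ e ∈ E, z ⊓ e = 0) → z = 0 := by
  obtain ⟨E, hE⟩ := zorn_subset
    {E : Set X | (∀ e ∈ E, 0 ≤ e ∧ ∃ x ∈ K, e ≤ x⁺ ∨ e ≤ (-x)⁺) ∧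
      ∀ e ∈ E, ∀ e' ∈ E, e ≠ e' → e ⊓ e' = 0}
    (fun c hcs hc => by
      refine ⟨⋃₀ c, ⟨?_, ?_⟩, fun s hs => subset_sUnion_of_mem hs⟩
      · rintro e ⟨s, hs, he⟩
        exact (hcs hs).1 e he
      · rintro e ⟨s, hs, he⟩ e' ⟨s', hs', he'⟩
        rcases hc.total hs hs' with h | h
        · exact (hcs hs').2 e (h he) e' he'
        · exact (hcs hs).2 e he e' (h he'))
  refine ⟨E, hE.prop.1, hE.prop.2, fun z hz hzE => ?_⟩
  -- `y ⊓ z` could be added to `E`, so it belongs to `E` and is disjoint from itself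
  have key : ∀ x ∈ K, ∀ y, 0 ≤ y → (y ≤ x⁺ ∨ y ≤ (-x)⁺) → y ⊓ z = 0 := by
    intro x hx y hy hyx
    have hw0 : 0 ≤ y ⊓ z := le_inf hy hz
    have hdisj : ∀ e ∈ E, y ⊓ z ⊓ e = 0 := fun e he => le_antisymm
      ((inf_le_inf inf_le_right le_rfl).trans_eq (hzE e he)) (le_inf hw0 (hE.prop.1 e he).1)
    have hmem : y ⊓ z ∈ E := hE.mem_of_prop_insert ⟨by
      rintro e (rfl | he)
      · exact ⟨hw0, x, hx, hyx.imp inf_le_left.trans inf_le_left.trans⟩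
      · exact hE.prop.1 e he, by
      rintro e (rfl | he) e' (rfl | he') hne
      · exact absurd rfl hne
      · exact hdisj e' he'
      · rw [inf_comm]
        exact hdisj e he
      · exact hE.prop.2 e he e' he' hne⟩
    simpa using hdisj _ hmem
  have hsub : K ⊆ disjointComplement hz := fun x hx => by
    change |x| ⊓ z = 0
    rw [← posPart_add_negPart]
    exact add_inf_eq_zero (posPart_nonneg x) (negPart_nonneg x) hz
      (key x hx _ (posPart_nonneg x) (Or.inl le_rfl))
      (key x hx _ (negPart_nonneg x) (Or.inr (posPart_neg x).ge))
  have hz' : z ∈ disjointComplement hz := by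
    have : z ∈ bandGenerated K := hK ▸ Submodule.mem_top
    rw [bandGenerated, Submodule.mem_sInf] at this
    exact this _ ⟨isBand_disjointComplement hz, hsub⟩
  rwa [mem_disjointComplement, abs_of_nonneg hz, inf_idem] at hz'

omit [HasSolidNorm X] in
lemma mem_of_le_nsmul_sum {E : Set X} {Z : Submodule ℝ X} (hE : ∀ e ∈ E, 0 ≤ e)
    (hZ : ∀ e ∈ E, Icc 0 e ⊆ (Z : Set X)) (t : Finset E) (n : ℕ) {y : X} (hy0 : 0 ≤ y)
    (hy : y ≤ n • ∑ e ∈ t, (e : X)) : y ∈ Z := by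
  classical
  induction t using Finset.induction_on generalizing y with
  | empty =>
    rw [Finset.sum_empty, nsmul_zero] at hy
    rw [le_antisymm hy hy0]
    exact Z.zero_mem
  | insert e t he ih =>
    rw [Finset.sum_insert he, nsmul_add] at hy
    have hne0 : 0 ≤ n • (e : X) := nsmul_nonneg (hE e e.2) n
    have h1 : y ⊓ n • (e : X) ∈ Z := by
      rcases Nat.eq_zero_or_pos n with rfl | hn
      · simp [inf_eq_right.2 hy0]
      · have hn0 : (0 : ℝ) < n := by exact_mod_cast hn
        have hinv : 0 ≤ (n : ℝ)⁻¹ := (inv_pos.2 hn0).le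
        have h2 : (n : ℝ)⁻¹ • (y ⊓ n • (e : X)) ∈ Z := hZ e e.2
          ⟨smul_nonneg hinv (le_inf hy0 hne0),
            (smul_le_smul_of_nonneg_left inf_le_right hinv).trans_eq (by
              rw [← Nat.cast_smul_eq_nsmul ℝ, inv_smul_smul₀ hn0.ne'])⟩
        have h3 := Z.smul_mem (n : ℝ) h2
        rwa [smul_inv_smul₀ hn0.ne'] at h3
    have h4 : y - y ⊓ n • (e : X) ∈ Z := by
      refine ih (sub_nonneg.2 inf_le_left) ?_
      rw [sub_le_iff_le_add, add_inf, add_comm _ (n • (e : X))]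
      exact le_inf (le_add_of_nonneg_left
        (nsmul_nonneg (Finset.sum_nonneg fun (i : E) _ => hE i i.2) n)) hy
    simpa using Z.add_mem h4 h1

/-- The order intervals `[0, e]`, with `e` in a family of positive elements which is only disjoint
from `0`, generate `X` as a closed subspace: `x ≥ 0` is the limit of `x ⊓ n • ∑ e ∈ t, e`. -/
lemma topologicalClosure_span_iUnion_Icc [CompleteSpace X] (hX : IsOrderContinuous X) {E : Set X}
    (hE : ∀ e ∈ E, 0 ≤ e) (hmax : ∀ z, 0 ≤ z → (∀ e ∈ E, z ⊓ e = 0) → z = 0) :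
    (Submodule.span ℝ (⋃ e ∈ E, Icc 0 e)).topologicalClosure = ⊤ := by
  classical
  set Z := Submodule.span ℝ (⋃ e ∈ E, Icc 0 e) with hZ_def
  have hZ : ∀ e ∈ E, Icc 0 e ⊆ (Z : Set X) := fun e he =>
    (subset_biUnion_of_mem (u := fun e => Icc 0 e) he).trans Submodule.subset_span
  have hpos : ∀ x, 0 ≤ x → x ∈ Z.topologicalClosure := by
    intro x hx
    let u : Finset E × ℕ → X := fun p => x ⊓ p.2 • ∑ e ∈ p.1, (e : X)
    have hsum0 : ∀ t : Finset E, 0 ≤ ∑ e ∈ t, (e : X) := fun t =>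
      Finset.sum_nonneg fun i _ => hE i i.2
    have hu : Monotone u := fun p q hpq => inf_le_inf le_rfl
      ((nsmul_le_nsmul_left (hsum0 _) hpq.2).trans (nsmul_le_nsmul_right
        (Finset.sum_le_sum_of_subset_of_nonneg hpq.1 fun i _ _ => hE i i.2) _))
    obtain ⟨s, hs⟩ := exists_tendsto_of_monotone hX hu fun p => inf_le_left
    have hsx : s ≤ x := le_of_tendsto' hs fun p => inf_le_left
    have hsZ : s ∈ Z.topologicalClosure :=
      mem_closure_of_tendsto hs (Eventually.of_forall fun p =>
        mem_of_le_nsmul_sum hE hZ p.1 p.2 (le_inf hx (nsmul_nonneg (hsum0 _) _)) inf_le_right)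
    have hxs : x - s = 0 := by
      refine hmax _ (sub_nonneg.2 hsx) fun e he => ?_
      refine le_antisymm ?_ (le_inf (sub_nonneg.2 hsx) (hE e he))
      have hstep : ∀ p, (x - s) ⊓ e + u p ≤ s := by
        rintro ⟨t, n⟩
        refine le_trans (le_inf ?_ ?_) (hu.ge_of_tendsto hs (insert ⟨e, he⟩ t, n + 1))
        · calc (x - s) ⊓ e + u (t, n) ≤ (x - s) + s :=
              add_le_add inf_le_left (hu.ge_of_tendsto hs (t, n))
            _ = x := sub_add_cancel x s
        · calc (x - s) ⊓ e + u (t, n) ≤ e + n • ∑ i ∈ t, (i : X) :=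
              add_le_add inf_le_right inf_le_right
            _ ≤ (∑ i ∈ insert ⟨e, he⟩ t, (i : X)) + n • ∑ i ∈ insert ⟨e, he⟩ t, (i : X) := by
              refine add_le_add ?_ (nsmul_le_nsmul_right ?_ n)
              · exact Finset.single_le_sum (f := fun i : E => (i : X)) (fun i _ => hE i i.2)
                  (Finset.mem_insert_self ⟨e, he⟩ t)
              · exact Finset.sum_le_sum_of_subset_of_nonneg (Finset.subset_insert _ _)
                  fun i _ _ => hE i i.2
            _ = (n + 1) • ∑ i ∈ insert ⟨e, he⟩ t, (i : X) := (succ_nsmul' _ _).symm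
      have hlim := le_of_tendsto' (hs.const_add ((x - s) ⊓ e)) hstep
      simpa using hlim
    rw [sub_eq_zero.1 hxs]
    exact hsZ
  refine eq_top_iff.2 fun x _ => ?_
  rw [← posPart_sub_negPart x]
  exact Submodule.sub_mem _ (hpos _ (posPart_nonneg x)) (hpos _ (negPart_nonneg x))

end DisjointFamily

/-! ### Weakly compactly generated Banach lattices -/

section WCG

variable {X : Type*} [NormedAddCommGroup X] [NormedSpace ℝ X] [CompleteSpace X] [Lattice X]
  [IsOrderedAddMonoid X] [IsOrderedModule ℝ X] [HasSolidNorm X]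

/-- If a disjoint family `E` of positive elements lies below `K ∪ -K` with `K` weakly precompact,
then the order intervals `[0, e]`, `e ∈ E`, form with `0` a weakly compact set: each of them is
weakly compact, and they tend weakly to `0`. -/
lemma isWeaklyCompact_insert_iUnion_Icc (hX : IsOrderContinuous X) {K E : Set X}
    (hK : IsWeaklyPrecompact K) (hE : ∀ e ∈ E, 0 ≤ e ∧ ∃ x ∈ K, e ≤ x⁺ ∨ e ≤ (-x)⁺)
    (hd : ∀ e ∈ E, ∀ e' ∈ E, e ≠ e' → e ⊓ e' = 0) :
    IsWeaklyCompact (insert 0 (⋃ e ∈ E, Icc 0 e)) := by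
  refine isWeaklyCompact_of_ultrafilter fun U hU => ?_
  by_cases hUE : ∃ e ∈ E, Icc 0 e ∈ U
  · obtain ⟨e, he, heU⟩ := hUE
    obtain ⟨x, hx, hlim⟩ := exists_weak_limit_of_Icc hX U heU
    exact ⟨x, Or.inr (mem_biUnion he hx), hlim⟩
  · push Not at hUE
    refine ⟨0, Or.inl rfl, ?_⟩
    have hpos : ∀ f : X →L[ℝ] ℝ, IsPositiveMap f → Tendsto f U (𝓝 0) := by
      intro f hf
      refine Metric.tendsto_nhds.2 fun δ hδ => ?_
      have hfin : {e ∈ E | δ ≤ f e}.Finite := by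
        by_contra hinf
        let i := Set.Infinite.natEmbedding _ hinf
        obtain ⟨n, hn⟩ := exists_apply_lt_of_disjoint hX hK (e := fun n => (i n : X))
          (fun n => (hE _ (i n).2.1).1)
          (fun m n hmn => hd _ (i m).2.1 _ (i n).2.1
            (Subtype.val_injective.ne (i.injective.ne hmn)))
          (fun n => (hE _ (i n).2.1).2) hf hδ
        exact absurd (i n).2.2 (not_le.2 hn)
      have hnot : (⋃ e ∈ {e ∈ E | δ ≤ f e}, Icc 0 e) ∉ U := by
        rw [Ultrafilter.finite_biUnion_mem_iff hfin]
        rintro ⟨e, he, heU⟩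
        exact hUE e he.1 heU
      filter_upwards [hU, Ultrafilter.compl_mem_iff_notMem.2 hnot] with y hy hy'
      rw [dist_zero_right]
      rcases hy with rfl | hy
      · simpa using hδ
      · obtain ⟨e, he, hye⟩ := mem_iUnion₂.1 hy
        have hlt : f e < δ := by
          by_contra hle
          exact hy' (mem_biUnion (show e ∈ {e ∈ E | δ ≤ f e} from ⟨he, not_lt.1 hle⟩) hye)
        rw [Real.norm_of_nonneg (hf y hye.1)]
        exact (hf.mono hye.2).trans_lt hlt
    intro f
    obtain ⟨g, h, hg, hh, rfl⟩ := exists_positive_sub_positive f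
    rw [map_zero]
    have := (hpos g hg).sub (hpos h hh)
    rwa [sub_zero] at this

/-- A Banach lattice with order continuous norm which is generated as a band by a weakly precompact
set is weakly compactly generated. -/
lemma isWCG_of_bandGenerated_eq_top (hX : IsOrderContinuous X) {K : Set X}
    (hK : IsWeaklyPrecompact K) (hKX : bandGenerated K = ⊤) : IsWCG X := by
  obtain ⟨E, hE, hd, hmax⟩ := exists_maximal_disjoint_family hKX
  refine ⟨_, isWeaklyCompact_insert_iUnion_Icc hX hK hE hd, ?_⟩
  rw [Submodule.span_insert_zero]
  exact topologicalClosure_span_iUnion_Icc hX (fun e he => (hE e he).1) hmax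

end WCG

lemma IsWCG.isWPG {X : Type*} [NormedAddCommGroup X] [NormedSpace ℝ X] (h : IsWCG X) :
    IsWPG X := by
  obtain ⟨K, hK, hspan⟩ := h
  exact ⟨K, hK.isWeaklyPrecompact, hspan⟩

lemma bandGenerated_eq_top_of_span {X : Type*} [NormedAddCommGroup X] [NormedSpace ℝ X]
    [Lattice X] {K : Set X} (h : (Submodule.span ℝ K).topologicalClosure = ⊤) :
    bandGenerated K = ⊤ := by
  refine top_le_iff.1 (h ▸ Submodule.topologicalClosure_minimal _ (Submodule.span_le.2 ?_)
    (isBand_bandGenerated K).isClosed)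
  intro x hx
  rw [SetLike.mem_coe, bandGenerated, Submodule.mem_sInf]
  exact fun Z hZ => hZ.2 hx

end BanachLattice

theorem corollary3p5 (X : Type*) [NormedAddCommGroup X] [NormedSpace ℝ X] [CompleteSpace X]
    [Lattice X] [IsOrderedAddMonoid X] [IsOrderedModule ℝ X] [HasSolidNorm X]
    (hX : BanachLattice.IsOrderContinuous X) :
    (BanachLattice.IsWCG X ↔ BanachLattice.IsWPG X) ∧
      (BanachLattice.IsWCG X ↔
        ∃ K : Set X, BanachLattice.IsWeaklyPrecompact K ∧
          BanachLattice.bandGenerated K = ⊤) := by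
  have h23 : BanachLattice.IsWPG X → ∃ K : Set X, BanachLattice.IsWeaklyPrecompact K ∧
      BanachLattice.bandGenerated K = ⊤ := by
    rintro ⟨K, hK, hspan⟩
    exact ⟨K, hK, BanachLattice.bandGenerated_eq_top_of_span hspan⟩
  have h31 : (∃ K : Set X, BanachLattice.IsWeaklyPrecompact K ∧
      BanachLattice.bandGenerated K = ⊤) → BanachLattice.IsWCG X := by
    rintro ⟨K, hK, hKX⟩
    exact BanachLattice.isWCG_of_bandGenerated_eq_top hX hK hKX
  exact ⟨⟨fun h => h.isWPG, fun h => h31 (h23 h)⟩, ⟨fun h => h23 h.isWPG, h31⟩⟩
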